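/- Let $C$ be a geometrically irreducible smooth projective curve over a finite field $\mathbb F$ with $q$ elements, with function field $K$, let $\infty$ be a closed point of $C$, and let $A=H^0(C\setminus\{\infty\},\mathcal O_C)\subset K$. (Equivalently, $K/\mathbb F$ is a finitely generated field extension of transcendence degree one in which $\mathbb F$ is algebraically closed, the closed points of $C$ are the discrete valuation rings of $K/\mathbb F$, and $A$ is the ring of elements of $K$ lying in all of these rings except possibly that of $\infty$.) Let $K_\infty$ be the completion of $K$ at $\infty$, $K_\infty^s$ a separable closure of $K_\infty$ with the norm extending that of $K_\infty$, $\mathbb C_\infty$ its completion, and $G_\infty=\operatorname{Gal}(K_\infty^s|K_\infty)$ with the profinite topology, acting by continuity on $\mathbb C_\infty$. Unlabelled tensor products are over $\mathbb F$. Let $\tau$ be the endomorphism $a\otimes r\mapsto a\otimes r^q$ of $A\otimes K$, and let $\mathfrak j$ be the kernel of $A\otimes K\to K$, $a\otimes r\mapsto ar$. An $A$-motive $\underline M=(M,\tau_M)$ over $K$ is a finite locally free $A\otimes K$-module $M$ with an $A\otimes K$-linear isomorphism $\tau_M:(\tau^*M)[\mathfrak j^{-1}]\to M[\mathfrak j^{-1}]$,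 where $N[\mathfrak j^{-1}]$ is the module of all $x\in N\otimes_{A\otimes K}\operatorname{Quot}(A\otimes K)$ with $\mathfrak j^nx\subset N$ for some $n\ge 0$; a morphism is an $A\otimes K$-linear map $f:M\to N$ with $f\circ\tau_M=\tau_N\circ\tau^*f$. A sequence of $A$-motives is exact if the underlying sequence of modules is. For a complete field $L$ with $K\subset L\subset\mathbb C_\infty$, let $L\langle A\rangle$ be the completion of $A\otimes L$ for the topology in which the subgroups $A\otimes\{c\in L:|c|\le r\}$, $r>0$, form a basis of neighbourhoods of $0$, and let $\tau$ be the continuous extension of $a\otimes c\mapsto a\otimes c^q$. The ideal $\mathfrak j$ generates the unit ideal of $\mathbb C_\infty\langle A\rangle$, so that $\tau_M$ extends to $\tau^*(M\otimes_{A\otimes K}\mathbb C_\infty\langle A\rangle)\cong M\otimes_{A\otimes K}\mathbb C_\infty\langle A\rangle$. The Betti realization of $\underline M$ is the $A$-module $$M_B=\{\omega\in M\otimes_{A\otimes K}\mathbb C_\infty\langle A\rangle \mid \omega=\tau_M(\tau^*\omega)\},$$ with the $A$-linear action of $G_\infty$ induced by its action on $\mathbb C_\infty$. The $A$-motive $\underline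 M$ is called rigid analytically trivial if the multiplication map $M_B\otimes_A\mathbb C_\infty\langle A\rangle\to M\otimes_{A\otimes K}\mathbb C_\infty\langle A\rangle$ is bijective. Then: (1) For every rigid analytically trivial $A$-motive $\underline M$ over $K$ there is a finite separable field extension $L$ of $K_\infty$ in $\mathbb C_\infty$ such that $M_B$ is contained in (the image of) $M\otimes_{A\otimes K}L\langle A\rangle$. (2) For every such $\underline M$, the action of $G_\infty$ on $M_B$, equipped with the discrete topology, is continuous. (3) The resulting functor $\underline M\mapsto M_B$, from the full subcategory of rigid analytically trivial $A$-motives over $K$ to the category of continuous $A$-linear representations of $G_\infty$ (discrete $A$-modules with a continuous $A$-linear action), is exact: it is additive and maps every short exact sequence $0\to\underline M'\to\underline M\to\underline M''\to 0$ of rigid analytically trivial $A$-motives to a short exact sequence $0\to M'_B\to M_B\to M''_B\to 0$. -/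

import Mathlib

open CategoryTheory TensorProduct
open scoped nonZeroDivisors NNReal

universe u

noncomputable section

namespace AMot

/-! ### The curve and the point at infinity

A geometrically irreducible smooth projective curve over the finite field `F` is given by its
function field `K`: a finitely generated extension of `F` of transcendence degree one in which
`F` is algebraically closed. Its closed points are the discrete valuation rings of `K / F`. -/

/-- `K` is the function field of a geometrically irreducible smooth projective curve over the
(finite, hence perfect) field `F`. -/
class IsCurveFunctionField (F K : Type u) [Field F] [Field K] [Algebra F K] : Prop where
  fg : (⊤ : IntermediateField F K).FG
  trdeg_eq_one : Algebra.trdeg F K = 1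
  constants : ∀ x : K, IsIntegral F x → x ∈ (algebraMap F K).range

/-- A closed point of the smooth projective curve with function field `K`, given by its
local ring. -/
@[ext]
structure ClosedPoint (F K : Type u) [Field F] [Field K] [Algebra F K] where
  /-- the local ring at the point -/
  localRing : ValuationSubring K
  algebraMap_mem : ∀ c : F, algebraMap F K c ∈ localRing
  isDVR : IsDiscreteValuationRing localRing

section Curve

variable {F K : Type u} [Field F] [Field K] [Algebra F K]

/-- The ring `A` of functions on the curve that are regular away from the closed point `P`. -/
def ClosedPoint.regularAway (P : ClosedPoint F K) : Subalgebra F K where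
  carrier := {x | ∀ Q : ClosedPoint F K, Q ≠ P → x ∈ Q.localRing}
  mul_mem' ha hb Q hQ := mul_mem (ha Q hQ) (hb Q hQ)
  add_mem' ha hb Q hQ := add_mem (ha Q hQ) (hb Q hQ)
  algebraMap_mem' c Q _ := Q.algebraMap_mem c

variable [Fintype F]

/-- The absolute value of `K` at `P`, normalized so that a uniformizer has absolute value
`1 / |F|` (replacing it by a power changes nothing below). -/
def ClosedPoint.abv (P : ClosedPoint F K) : AbsoluteValue K ℝ :=
  haveI := P.isDVR
  (IsDiscreteValuationRing.maximalIdeal P.localRing).adicAbv (K := K)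
    (b := (Fintype.card F : ℝ≥0)) (by exact_mod_cast Fintype.one_lt_card)

theorem ClosedPoint.isNonarchimedean_abv (P : ClosedPoint F K) : IsNonarchimedean P.abv :=
  have := P.isDVR
  (IsDiscreteValuationRing.maximalIdeal P.localRing).isNonarchimedean_adicAbv _

/-- `K_∞`, the completion of `K` at `P`. -/
def Kinf (P : ClosedPoint F K) : Type u := P.abv.Completion

variable (P : ClosedPoint F K)

instance : NormedField (Kinf P) := inferInstanceAs (NormedField P.abv.Completion)

instance : CompleteSpace (Kinf P) := inferInstanceAs (CompleteSpace P.abv.Completion)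

/-- The inclusion of `K` in `K_∞`. -/
def toKinf : K →+* Kinf P :=
  (UniformSpace.Completion.coeRingHom (α := WithAbs P.abv)).comp
    (WithAbs.equiv P.abv).symm.toRingHom

instance : Algebra K (Kinf P) := (toKinf P).toAlgebra
instance : Algebra F (Kinf P) := ((toKinf P).comp (algebraMap F K)).toAlgebra
instance : IsScalarTower F K (Kinf P) := .of_algebraMap_eq fun _ => rfl

theorem norm_toKinf (x : K) : ‖toKinf P x‖ = P.abv x :=
  (UniformSpace.Completion.norm_coe (E := WithAbs P.abv) _).trans rfl

instance : IsUltrametricDist (Kinf P) := by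
  refine IsUltrametricDist.isUltrametricDist_of_forall_norm_add_le_max_norm fun x y => ?_
  refine UniformSpace.Completion.induction_on₂ (α := WithAbs P.abv) (β := WithAbs P.abv)
    (p := fun x y : Kinf P => ‖x + y‖ ≤ max ‖x‖ ‖y‖) x y ?_ fun a b => ?_
  · exact isClosed_le ((continuous_fst.add continuous_snd).norm)
      (continuous_fst.norm.max continuous_snd.norm)
  · have h := P.isNonarchimedean_abv (WithAbs.equiv P.abv a) (WithAbs.equiv P.abv b)
    rw [← norm_toKinf, ← norm_toKinf, ← norm_toKinf, map_add] at h
    exact h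

theorem exists_one_lt_norm : ∃ x : Kinf P, 1 < ‖x‖ := by
  have := P.isDVR
  obtain ⟨r, hr, hr0⟩ := Submodule.exists_mem_ne_zero_of_ne_bot
    (IsDiscreteValuationRing.maximalIdeal P.localRing).ne_bot
  have h1 : P.abv r < 1 :=
    (IsDedekindDomain.HeightOneSpectrum.adicAbv_coe_lt_one_iff (K := K) _ _ r).2 hr
  have h0 : 0 < P.abv r := P.abv.pos (by simpa using hr0)
  refine ⟨toKinf P (r : K)⁻¹, ?_⟩
  rw [norm_toKinf, map_inv₀]
  exact (one_lt_inv₀ h0).2 h1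

instance : NontriviallyNormedField (Kinf P) where
  non_trivial := exists_one_lt_norm P

/-- `K_∞^s`, the separable closure of `K_∞`. -/
def KinfSep : Type u := SeparableClosure (Kinf P)

instance : Field (KinfSep P) := inferInstanceAs (Field (SeparableClosure (Kinf P)))
instance : Algebra (Kinf P) (KinfSep P) :=
  inferInstanceAs (Algebra (Kinf P) (SeparableClosure (Kinf P)))
instance : IsSepClosure (Kinf P) (KinfSep P) :=
  inferInstanceAs (IsSepClosure (Kinf P) (SeparableClosure (Kinf P)))
instance : Algebra.IsAlgebraic (Kinf P) (KinfSep P) :=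
  inferInstanceAs (Algebra.IsAlgebraic (Kinf P) (SeparableClosure (Kinf P)))

/-- The spectral norm on `K_∞^s`: the unique extension of the norm of `K_∞`. -/
instance : NormedField (KinfSep P) := spectralNorm.normedField (Kinf P) (KinfSep P)

/-- `ℂ_∞`, the completion of the separable closure `K_∞^s` of `K_∞`. -/
def Cinf : Type u := UniformSpace.Completion (KinfSep P)

instance : NormedField (Cinf P) :=
  inferInstanceAs (NormedField (UniformSpace.Completion (KinfSep P)))

instance : CompleteSpace (Cinf P) :=
  inferInstanceAs (CompleteSpace (UniformSpace.Completion (KinfSep P)))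

/-- The inclusion of `K_∞^s` in `ℂ_∞`. -/
def toCinf : KinfSep P →+* Cinf P :=
  UniformSpace.Completion.coeRingHom

instance : Algebra (KinfSep P) (Cinf P) := (toCinf P).toAlgebra
instance : Algebra (Kinf P) (Cinf P) :=
  ((toCinf P).comp (algebraMap (Kinf P) (KinfSep P))).toAlgebra
instance : Algebra K (Cinf P) := ((algebraMap (Kinf P) (Cinf P)).comp (toKinf P)).toAlgebra
instance : Algebra F (Cinf P) := ((algebraMap K (Cinf P)).comp (algebraMap F K)).toAlgebra
instance : IsScalarTower (Kinf P) (KinfSep P) (Cinf P) :=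
  .of_algebraMap_eq fun _ => rfl
instance : IsScalarTower K (Kinf P) (Cinf P) := .of_algebraMap_eq fun _ => rfl
instance : IsScalarTower F (Kinf P) (Cinf P) := .of_algebraMap_eq fun _ => rfl
instance : IsScalarTower F K (Cinf P) := .of_algebraMap_eq fun _ => rfl

instance (L : IntermediateField (Kinf P) (Cinf P)) : IsScalarTower F K L :=
  .of_algebraMap_eq fun _ => rfl

/-- `G_∞ = Gal(K_∞^s / K_∞)`, a topological group for the Krull topology. -/
abbrev Ginf : Type u := Gal(KinfSep P/Kinf P)

theorem continuous_galois (σ : Ginf P) : Continuous σ := by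
  refine Isometry.continuous (AddMonoidHomClass.isometry_of_norm σ fun x => ?_)
  exact (spectralNorm_eq_of_equiv σ x).symm

/-- The action of `G_∞` on `ℂ_∞`, obtained by continuity. -/
def galCinf (σ : Ginf P) : Cinf P →ₐ[Kinf P] Cinf P where
  __ := UniformSpace.Completion.mapRingHom
    (σ : KinfSep P →+* KinfSep P) (continuous_galois P σ)
  commutes' x := by
    refine (UniformSpace.Completion.mapRingHom_coe (continuous_galois P σ) _).trans ?_
    exact congrArg _ (σ.commutes x)

theorem continuous_galCinf (σ : Ginf P) : Continuous (galCinf P σ) :=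
  UniformSpace.Completion.continuous_map

theorem galCinf_toCinf (σ : Ginf P) (x : KinfSep P) :
    galCinf P σ (toCinf P x) = toCinf P (σ x) :=
  UniformSpace.Completion.mapRingHom_coe (continuous_galois P σ) x

theorem denseRange_toCinf : DenseRange (toCinf P) :=
  UniformSpace.Completion.denseRange_coe (α := KinfSep P)

theorem galCinf_one (x : Cinf P) : galCinf P 1 x = x :=
  congrFun ((denseRange_toCinf P).equalizer (continuous_galCinf P 1) continuous_id
    (funext fun y => galCinf_toCinf P 1 y)) x

theorem galCinf_mul (σ σ' : Ginf P) (x : Cinf P) :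
    galCinf P (σ * σ') x = galCinf P σ (galCinf P σ' x) :=
  congrFun ((denseRange_toCinf P).equalizer (continuous_galCinf P (σ * σ'))
    ((continuous_galCinf P σ).comp (continuous_galCinf P σ'))
    (funext fun y => by
      simp only [Function.comp_apply, galCinf_toCinf, AlgEquiv.mul_apply])) x

end Curve

section Tate

/-! ### Tate algebras

For a complete nonarchimedean field `L` over `F`, the Tate algebra `L⟨A⟩` is the completion of
`A ⊗ L` for the topology in which the subgroups `A ⊗ {c | ‖c‖ ≤ r}`, `r > 0`, form a basis of
neighbourhoods of zero. (It is `L ⊗_{𝒪_L} 𝒪_L⟨A⟩`, where `𝒪_L⟨A⟩` is the completion of `A ⊗ 𝒪_L`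
for the topology induced by the norm of `L`.) -/

variable (F A L : Type u) [Field F] [CommRing A] [Algebra F A] [NormedField L] [Algebra F L]

/-- `A ⊗ L`, to be equipped with its norm topology. -/
def PreTate : Type u := A ⊗[F] L

instance : CommRing (PreTate F A L) := inferInstanceAs (CommRing (A ⊗[F] L))

/-- The identity of `A ⊗ L`. -/
def PreTate.of : A ⊗[F] L ≃+* PreTate F A L := RingEquiv.refl (A ⊗[F] L)

/-- The image of `A ⊗ {c | ‖c‖ ≤ r}` in `A ⊗ L`. -/
def PreTate.ball (r : {r : ℝ // 0 < r}) : AddSubgroup (PreTate F A L) :=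
  AddSubgroup.closure {x | ∃ (a : A) (c : L), ‖c‖ ≤ r ∧ x = PreTate.of F A L (a ⊗ₜ c)}

variable {F A L} in
theorem PreTate.tmul_mem_ball {r : {r : ℝ // 0 < r}} (a : A) {c : L} (hc : ‖c‖ ≤ r) :
    PreTate.of F A L (a ⊗ₜ c) ∈ PreTate.ball F A L r :=
  AddSubgroup.subset_closure ⟨a, c, hc, rfl⟩

theorem PreTate.ball_mono {r s : {r : ℝ // 0 < r}} (h : r ≤ s) :
    PreTate.ball F A L r ≤ PreTate.ball F A L s :=
  AddSubgroup.closure_mono fun _ ⟨a, c, hc, hx⟩ => ⟨a, c, hc.trans h, hx⟩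

theorem PreTate.ball_mul {r s t : {r : ℝ // 0 < r}} (h : (r : ℝ) * s ≤ t) {x y : PreTate F A L}
    (hx : x ∈ PreTate.ball F A L r) (hy : y ∈ PreTate.ball F A L s) :
    x * y ∈ PreTate.ball F A L t := by
  induction hx using AddSubgroup.closure_induction with
  | zero => simp
  | add x x' _ _ h1 h2 => rw [add_mul]; exact add_mem h1 h2
  | neg x _ h1 => rw [neg_mul]; exact neg_mem h1
  | mem x hx =>
    obtain ⟨a, c, hc, rfl⟩ := hx
    induction hy using AddSubgroup.closure_induction with
    | zero => simp
    | add y y' _ _ h1 h2 => rw [mul_add]; exact add_mem h1 h2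
    | neg y _ h1 => rw [mul_neg]; exact neg_mem h1
    | mem y hy =>
      obtain ⟨b, d, hd, rfl⟩ := hy
      rw [← map_mul, Algebra.TensorProduct.tmul_mul_tmul]
      refine PreTate.tmul_mem_ball _ ?_
      rw [norm_mul]
      exact (mul_le_mul hc hd (norm_nonneg _) r.2.le).trans h

theorem PreTate.exists_mem_ball (x : PreTate F A L) : ∃ r, x ∈ PreTate.ball F A L r := by
  obtain ⟨x, rfl⟩ := (PreTate.of F A L).surjective x
  induction x using TensorProduct.induction_on with
  | zero => exact ⟨⟨1, one_pos⟩, by rw [map_zero]; exact zero_mem _⟩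
  | tmul a c =>
    exact ⟨⟨‖c‖ + 1, by positivity⟩, PreTate.tmul_mem_ball a (by simp)⟩
  | add x y hx hy =>
    obtain ⟨r, hr⟩ := hx
    obtain ⟨s, hs⟩ := hy
    exact ⟨r ⊔ s, by
      rw [map_add]
      exact add_mem (PreTate.ball_mono F A L le_sup_left hr)
        (PreTate.ball_mono F A L le_sup_right hs)⟩

instance : Nonempty {r : ℝ // 0 < r} := ⟨⟨1, one_pos⟩⟩

theorem PreTate.ringSubgroupsBasis : RingSubgroupsBasis (PreTate.ball F A L) := by
  refine RingSubgroupsBasis.of_comm _ (fun r s => ⟨r ⊓ s, le_inf ?_ ?_⟩) (fun r => ?_)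
    fun x r => ?_
  · exact PreTate.ball_mono F A L inf_le_left
  · exact PreTate.ball_mono F A L inf_le_right
  · refine ⟨r ⊓ ⟨1, one_pos⟩, ?_⟩
    rintro _ ⟨x, hx, y, hy, rfl⟩
    refine PreTate.ball_mul F A L (r := r ⊓ ⟨1, one_pos⟩) (s := ⟨1, one_pos⟩) ?_ hx
      (PreTate.ball_mono F A L inf_le_right hy)
    exact (mul_one _).trans_le (inf_le_left : r ⊓ ⟨1, one_pos⟩ ≤ r)
  · obtain ⟨s, hs⟩ := PreTate.exists_mem_ball F A L x
    refine ⟨⟨r / s, div_pos r.2 s.2⟩, fun y hy => ?_⟩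
    exact PreTate.ball_mul F A L (mul_div_cancel₀ _ s.2.ne').le hs hy

instance : TopologicalSpace (PreTate F A L) := (PreTate.ringSubgroupsBasis F A L).topology

instance : IsTopologicalRing (PreTate F A L) :=
  (PreTate.ringSubgroupsBasis F A L).toRingFilterBasis.isTopologicalRing

instance : UniformSpace (PreTate F A L) := IsTopologicalAddGroup.rightUniformSpace _

instance : IsUniformAddGroup (PreTate F A L) := isUniformAddGroup_of_addCommGroup

/-- The Tate algebra `L⟨A⟩`. -/
def Tate : Type u := UniformSpace.Completion (PreTate F A L)

instance : CommRing (Tate F A L) :=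
  inferInstanceAs (CommRing (UniformSpace.Completion (PreTate F A L)))

instance : UniformSpace (Tate F A L) :=
  inferInstanceAs (UniformSpace (UniformSpace.Completion (PreTate F A L)))

instance : T2Space (Tate F A L) :=
  inferInstanceAs (T2Space (UniformSpace.Completion (PreTate F A L)))

/-- The canonical map `A ⊗ L → L⟨A⟩`. -/
def toTate : A ⊗[F] L →+* Tate F A L :=
  (UniformSpace.Completion.coeRingHom (α := PreTate F A L)).comp (PreTate.of F A L).toRingHom

theorem denseRange_toTate : DenseRange (toTate F A L) :=
  (UniformSpace.Completion.denseRange_coe (α := PreTate F A L)).comp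
    (PreTate.of F A L).surjective.denseRange (UniformSpace.Completion.continuous_coe _)

variable {L} {L' : Type u} [NormedField L'] [Algebra F L']

/-- `id ⊗ g : A ⊗ L → A ⊗ L'`. -/
def PreTate.map (g : L →ₐ[F] L') : PreTate F A L →+* PreTate F A L' :=
  ((PreTate.of F A L').toRingHom.comp
    (Algebra.TensorProduct.map (AlgHom.id F A) g : A ⊗[F] L →ₐ[F] A ⊗[F] L').toRingHom).comp
    (PreTate.of F A L).symm.toRingHom

theorem PreTate.map_of (g : L →ₐ[F] L') (x : A ⊗[F] L) :
    PreTate.map F A g (PreTate.of F A L x) =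
      PreTate.of F A L' (Algebra.TensorProduct.map (AlgHom.id F A) g x) := rfl

theorem PreTate.continuous_map (g : L →ₐ[F] L') (hg : Continuous g) :
    Continuous (PreTate.map F A g) := by
  refine continuous_of_continuousAt_zero _ ?_
  have h := (PreTate.ringSubgroupsBasis F A L).hasBasis_nhds_zero
  have h' := (PreTate.ringSubgroupsBasis F A L').hasBasis_nhds_zero
  rw [ContinuousAt, map_zero]
  refine (h.tendsto_iff h').2 fun r _ => ?_
  obtain ⟨δ, hδ, hd⟩ := Metric.continuousAt_iff.1 (hg.continuousAt (x := (0 : L))) r r.2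
  refine ⟨⟨δ / 2, half_pos hδ⟩, trivial, fun x hx => ?_⟩
  induction hx using AddSubgroup.closure_induction with
  | zero => rw [map_zero]; exact zero_mem _
  | add x y _ _ h1 h2 => rw [map_add]; exact add_mem h1 h2
  | neg x _ h1 => rw [map_neg]; exact neg_mem h1
  | mem x hx =>
    obtain ⟨a, c, hc, rfl⟩ := hx
    have hc' : dist c 0 < δ := by rw [dist_zero_right]; exact hc.trans_lt (half_lt_self hδ)
    have := hd hc'
    rw [map_zero, dist_zero_right] at this
    rw [PreTate.map_of, Algebra.TensorProduct.map_tmul]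
    exact PreTate.tmul_mem_ball _ this.le

/-- The map `L⟨A⟩ → L'⟨A⟩` induced by a continuous `F`-algebra morphism `L → L'`. -/
def Tate.map (g : L →ₐ[F] L') (hg : Continuous g) : Tate F A L →+* Tate F A L' :=
  UniformSpace.Completion.mapRingHom (PreTate.map F A g) (PreTate.continuous_map F A g hg)

theorem Tate.continuous_map (g : L →ₐ[F] L') (hg : Continuous g) :
    Continuous (Tate.map F A g hg) :=
  UniformSpace.Completion.continuous_map

theorem Tate.map_toTate (g : L →ₐ[F] L') (hg : Continuous g) (x : A ⊗[F] L) :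
    Tate.map F A g hg (toTate F A L x) =
      toTate F A L' (Algebra.TensorProduct.map (AlgHom.id F A) g x) :=
  UniformSpace.Completion.mapRingHom_coe (PreTate.continuous_map F A g hg) (PreTate.of F A L x)

variable {F A} in
theorem Tate.hom_ext {X : Type*} [TopologicalSpace X] [T2Space X] {f g : Tate F A L → X}
    (hf : Continuous f) (hg : Continuous g)
    (h : ∀ x, f (toTate F A L x) = g (toTate F A L x)) : f = g :=
  (denseRange_toTate F A L).equalizer hf hg (funext h)

variable (L)
variable (K : Type u) [Field K] [Algebra F K] [Algebra K L] [IsScalarTower F K L]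

instance : Algebra (A ⊗[F] K) (Tate F A L) :=
  ((toTate F A L).comp (Algebra.TensorProduct.map (AlgHom.id F A)
    (IsScalarTower.toAlgHom F K L) : A ⊗[F] K →ₐ[F] A ⊗[F] L).toRingHom).toAlgebra

instance : Algebra A (Tate F A L) :=
  ((toTate F A L).comp (Algebra.TensorProduct.includeLeft : A →ₐ[F] A ⊗[F] L).toRingHom).toAlgebra

theorem Tate.algebraMap_tmul (a : A) (r : K) :
    algebraMap (A ⊗[F] K) (Tate F A L) (a ⊗ₜ r) = toTate F A L (a ⊗ₜ algebraMap K L r) := rfl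

instance : IsScalarTower A (A ⊗[F] K) (Tate F A L) := .of_algebraMap_eq fun a => by
  rw [Algebra.TensorProduct.algebraMap_apply, Tate.algebraMap_tmul, map_one]; rfl

variable {L}
variable [Algebra K L'] [IsScalarTower F K L']

/-- The map `L⟨A⟩ → L'⟨A⟩` induced by a continuous `K`-algebra morphism `L → L'`, as an
`A ⊗ K`-algebra morphism. -/
def Tate.mapAlg (g : L →ₐ[K] L') (hg : Continuous g) :
    Tate F A L →ₐ[A ⊗[F] K] Tate F A L' where
  __ := Tate.map F A (g.restrictScalars F) (show Continuous (g.restrictScalars F) from hg)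
  commutes' x := by
    change Tate.map F A (g.restrictScalars F)
      (show Continuous (g.restrictScalars F) from hg) (algebraMap _ _ x) = _
    induction x using TensorProduct.induction_on with
    | zero => simp
    | add x y hx hy => simp only [map_add, hx, hy]
    | tmul a r =>
      rw [Tate.algebraMap_tmul, Tate.map_toTate, Algebra.TensorProduct.map_tmul,
        Tate.algebraMap_tmul]
      exact congrArg (fun c => toTate F A L' (a ⊗ₜ c)) (g.commutes r)

theorem Tate.continuous_mapAlg (g : L →ₐ[K] L') (hg : Continuous g) :
    Continuous (Tate.mapAlg F A K g hg) := Tate.continuous_map F A _ hg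

theorem Tate.mapAlg_toTate (g : L →ₐ[K] L') (hg : Continuous g) (x : A ⊗[F] L) :
    Tate.mapAlg F A K g hg (toTate F A L x) = toTate F A L'
      (Algebra.TensorProduct.map (AlgHom.id F A) (g.restrictScalars F) x) :=
  Tate.map_toTate F A _ hg x

variable (L) [Fintype F]

theorem continuous_frobeniusAlgHom {F : Type u} [Field F] (L : Type u) [NormedField L]
    [Algebra F L] [Fintype F] : Continuous (FiniteField.frobeniusAlgHom F L) :=
  continuous_pow (Fintype.card F)

/-- The endomorphism `τ` of `L⟨A⟩` extending `a ⊗ c ↦ a ⊗ c ^ q`, where `q = |F|`. -/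
def Tate.frob : Tate F A L →+* Tate F A L :=
  Tate.map F A (FiniteField.frobeniusAlgHom F L) (continuous_frobeniusAlgHom L)

theorem Tate.frob_tmul (a : A) (c : L) :
    Tate.frob F A L (toTate F A L (a ⊗ₜ c)) = toTate F A L (a ⊗ₜ (c ^ Fintype.card F)) :=
  Tate.map_toTate F A _ (continuous_frobeniusAlgHom L) _

theorem Tate.continuous_frob : Continuous (Tate.frob F A L) := Tate.continuous_map ..

/-- The endomorphism `τ` of `A ⊗ K`, `a ⊗ r ↦ a ⊗ r ^ q`, where `q = |F|`. -/
def tensorFrob : A ⊗[F] K →+* A ⊗[F] K :=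
  (Algebra.TensorProduct.map (AlgHom.id F A) (FiniteField.frobeniusAlgHom F K) :
    A ⊗[F] K →ₐ[F] A ⊗[F] K)

theorem Tate.frob_algebraMap (x : A ⊗[F] K) :
    Tate.frob F A L (algebraMap (A ⊗[F] K) (Tate F A L) x) =
      algebraMap (A ⊗[F] K) (Tate F A L) (tensorFrob F A K x) := by
  induction x using TensorProduct.induction_on with
  | zero => simp
  | add x y hx hy => simp only [map_add, hx, hy]
  | tmul a r =>
    rw [Tate.algebraMap_tmul, Tate.frob_tmul, ← map_pow]
    rfl

/-- `τ` on `L⟨A⟩` as a map semilinear over `τ` on `A ⊗ K`. -/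
def Tate.frobₛₗ : Tate F A L →ₛₗ[tensorFrob F A K] Tate F A L where
  __ := Tate.frob F A L
  map_smul' x y := by
    change Tate.frob F A L (x • y) = tensorFrob F A K x • Tate.frob F A L y
    rw [Algebra.smul_def, Algebra.smul_def, map_mul, Tate.frob_algebraMap]

variable {L}

theorem Tate.mapAlg_frob (g : L →ₐ[K] L') (hg : Continuous g) (x : Tate F A L) :
    Tate.mapAlg F A K g hg (Tate.frob F A L x) = Tate.frob F A L' (Tate.mapAlg F A K g hg x) := by
  refine congrFun (Tate.hom_ext (f := fun x => Tate.mapAlg F A K g hg (Tate.frob F A L x))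
    (g := fun x => Tate.frob F A L' (Tate.mapAlg F A K g hg x))
    ((Tate.continuous_mapAlg F A K g hg).comp (Tate.continuous_frob F A L))
    ((Tate.continuous_frob F A L').comp (Tate.continuous_mapAlg F A K g hg)) fun y => ?_) x
  induction y using TensorProduct.induction_on with
  | zero => simp
  | add y z hy hz => simp only [map_add, hy, hz]
  | tmul a c =>
    rw [Tate.frob_tmul, Tate.mapAlg_toTate, Tate.mapAlg_toTate, Algebra.TensorProduct.map_tmul,
      Algebra.TensorProduct.map_tmul, Tate.frob_tmul, map_pow]

end Tate

section Motive

/-! ### `A`-motives -/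

section Pullback

variable {R : Type u} [CommRing R] (φ : R →+* R)

/-- A copy of the ring `R`, which is an `R`-algebra through `φ`. -/
def TwistedRing (_ : R →+* R) : Type u := R

instance : CommRing (TwistedRing φ) := inferInstanceAs (CommRing R)

/-- The identity from `R` to its copy `TwistedRing φ`. -/
def TwistedRing.of : R ≃+* TwistedRing φ := RingEquiv.refl R

instance : Algebra R (TwistedRing φ) := ((TwistedRing.of φ).toRingHom.comp φ).toAlgebra

/-- The pullback `φ^* N = R ⊗_{φ, R} N`. -/
def Pullback (N : Type u) [AddCommGroup N] [Module R N] : Type u := TwistedRing φ ⊗[R] N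

variable (N : Type u) [AddCommGroup N] [Module R N]

instance : AddCommGroup (Pullback φ N) := inferInstanceAs (AddCommGroup (TwistedRing φ ⊗[R] N))

/-- `R` acts on `φ^* N = R ⊗_{φ, R} N` by multiplication on the first factor. -/
instance : Module R (Pullback φ N) :=
  Module.compHom (TwistedRing φ ⊗[R] N) (TwistedRing.of φ).toRingHom

/-- The `φ`-semilinear map `N → φ^* N`, `n ↦ 1 ⊗ n`. -/
def Pullback.mk : N →ₛₗ[φ] Pullback φ N where
  toFun n := ((1 : TwistedRing φ) ⊗ₜ[R] n : TwistedRing φ ⊗[R] N)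
  map_add' x y := TensorProduct.tmul_add _ x y
  map_smul' r x := by
    refine (TensorProduct.smul_tmul r (1 : TwistedRing φ) x).symm.trans ?_
    exact (TensorProduct.smul_tmul' (TwistedRing.of φ (φ r)) (1 : TwistedRing φ) x).symm

variable {N} {N' N'' : Type u} [AddCommGroup N'] [Module R N'] [AddCommGroup N''] [Module R N'']

/-- The pullback `φ^* f` of a linear map. -/
def Pullback.map (f : N →ₗ[R] N') : Pullback φ N →ₗ[R] Pullback φ N' where
  toFun x := LinearMap.baseChange (TwistedRing φ) f x
  map_add' x y := map_add (LinearMap.baseChange (TwistedRing φ) f) x y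
  map_smul' r x := map_smul (LinearMap.baseChange (TwistedRing φ) f) (TwistedRing.of φ r)
    (show TwistedRing φ ⊗[R] N from x)

theorem Pullback.map_mk (f : N →ₗ[R] N') (x : N) :
    Pullback.map φ f (Pullback.mk φ N x) = Pullback.mk φ N' (f x) :=
  LinearMap.baseChange_tmul (A := TwistedRing φ) (f := f) 1 x

theorem Pullback.map_id : Pullback.map φ (LinearMap.id : N →ₗ[R] N) = LinearMap.id := by
  ext x
  exact LinearMap.congr_fun (LinearMap.baseChange_id (A := TwistedRing φ) (M := N)) x

theorem Pullback.map_comp (g : N' →ₗ[R] N'') (f : N →ₗ[R] N') :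
    Pullback.map φ (g ∘ₗ f) = Pullback.map φ g ∘ₗ Pullback.map φ f := by
  ext x
  exact LinearMap.congr_fun (LinearMap.baseChange_comp (A := TwistedRing φ) (f := f) (g := g)) x

theorem Pullback.map_add (f g : N →ₗ[R] N') :
    Pullback.map φ (f + g) = Pullback.map φ f + Pullback.map φ g := by
  ext x
  exact LinearMap.congr_fun (LinearMap.baseChange_add (A := TwistedRing φ) (f := f) (g := g)) x

theorem Pullback.map_zero : Pullback.map φ (0 : N →ₗ[R] N') = 0 := by
  ext x
  exact LinearMap.congr_fun (LinearMap.baseChange_zero (A := TwistedRing φ) (R := R)) x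

theorem Pullback.map_neg (f : N →ₗ[R] N') : Pullback.map φ (-f) = -Pullback.map φ f := by
  ext x
  exact LinearMap.congr_fun (LinearMap.baseChange_neg (A := TwistedRing φ) (f := f)) x

end Pullback

section Poles

variable {R : Type u} [CommRing R] (j : Ideal R) (N : Type u) [AddCommGroup N] [Module R N]

/-- `N[j⁻¹]`: the submodule of `N ⊗ Quot(R)` of the elements `x` such that `j ^ n x ⊆ N` for
some `n`. For `N` finite locally free and `V(j)` a Cartier divisor, these are the sections of `N`
over `Spec R ∖ V(j)`. -/
def InvAlong : Submodule R (LocalizedModule R⁰ N) where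
  carrier := {x | ∃ n : ℕ, ∀ a ∈ j ^ n, a • x ∈ LinearMap.range (LocalizedModule.mkLinearMap R⁰ N)}
  zero_mem' := ⟨0, fun a _ => by rw [smul_zero]; exact zero_mem _⟩
  add_mem' := by
    rintro x y ⟨n, hn⟩ ⟨m, hm⟩
    refine ⟨n + m, fun a ha => ?_⟩
    rw [smul_add]
    exact add_mem (hn a (Ideal.pow_le_pow_right (Nat.le_add_right n m) ha))
      (hm a (Ideal.pow_le_pow_right (Nat.le_add_left m n) ha))
  smul_mem' := by
    rintro r x ⟨n, hn⟩
    refine ⟨n, fun a ha => ?_⟩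
    rw [smul_comm]
    exact Submodule.smul_mem _ r (hn a ha)

/-- The canonical map `N → N[j⁻¹]`. -/
def InvAlong.ι : N →ₗ[R] InvAlong j N :=
  (LocalizedModule.mkLinearMap R⁰ N).codRestrict _ fun x =>
    ⟨0, fun a _ => Submodule.smul_mem _ a ⟨x, rfl⟩⟩

variable {N} {N' N'' : Type u} [AddCommGroup N'] [Module R N'] [AddCommGroup N''] [Module R N'']

/-- The map `N ⊗ Quot(R) → N' ⊗ Quot(R)` induced by a linear map. -/
def locMap (f : N →ₗ[R] N') : LocalizedModule R⁰ N →ₗ[R] LocalizedModule R⁰ N' :=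
  IsLocalizedModule.map R⁰ (LocalizedModule.mkLinearMap R⁰ N) (LocalizedModule.mkLinearMap R⁰ N') f

theorem locMap_mk (f : N →ₗ[R] N') (x : N) :
    locMap f (LocalizedModule.mkLinearMap R⁰ N x) = LocalizedModule.mkLinearMap R⁰ N' (f x) :=
  IsLocalizedModule.map_apply ..

/-- The map `N[j⁻¹] → N'[j⁻¹]` induced by a linear map. -/
def InvAlong.map (f : N →ₗ[R] N') : InvAlong j N →ₗ[R] InvAlong j N' :=
  (locMap f).restrict <| by
    rintro x ⟨n, hn⟩
    refine ⟨n, fun a ha => ?_⟩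
    obtain ⟨y, hy⟩ := hn a ha
    exact ⟨f y, by rw [← map_smul, ← hy, locMap_mk]⟩

theorem InvAlong.map_ι (f : N →ₗ[R] N') (x : N) :
    InvAlong.map j f (InvAlong.ι j N x) = InvAlong.ι j N' (f x) :=
  Subtype.ext (locMap_mk f x)

theorem InvAlong.map_id : InvAlong.map j (LinearMap.id : N →ₗ[R] N) = LinearMap.id := by
  ext x
  exact LinearMap.congr_fun (IsLocalizedModule.map_id R⁰ (LocalizedModule.mkLinearMap R⁰ N)) x.1

theorem InvAlong.map_comp (g : N' →ₗ[R] N'') (f : N →ₗ[R] N') :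
    InvAlong.map j (g ∘ₗ f) = InvAlong.map j g ∘ₗ InvAlong.map j f := by
  ext x
  exact LinearMap.congr_fun (IsLocalizedModule.map_comp' R⁰ (LocalizedModule.mkLinearMap R⁰ N)
    (LocalizedModule.mkLinearMap R⁰ N') (LocalizedModule.mkLinearMap R⁰ N'') f g) x.1

theorem InvAlong.map_add (f g : N →ₗ[R] N') :
    InvAlong.map j (f + g) = InvAlong.map j f + InvAlong.map j g := by
  ext x
  exact LinearMap.congr_fun (_root_.map_add (IsLocalizedModule.map R⁰
    (LocalizedModule.mkLinearMap R⁰ N) (LocalizedModule.mkLinearMap R⁰ N')) f g) x.1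

theorem InvAlong.map_zero : InvAlong.map j (0 : N →ₗ[R] N') = 0 := by
  ext x
  exact LinearMap.congr_fun (_root_.map_zero (IsLocalizedModule.map R⁰
    (LocalizedModule.mkLinearMap R⁰ N) (LocalizedModule.mkLinearMap R⁰ N'))) x.1

theorem InvAlong.map_neg (f : N →ₗ[R] N') : InvAlong.map j (-f) = -InvAlong.map j f := by
  ext x
  exact LinearMap.congr_fun (_root_.map_neg (IsLocalizedModule.map R⁰
    (LocalizedModule.mkLinearMap R⁰ N) (LocalizedModule.mkLinearMap R⁰ N')) f) x.1

end Poles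

variable (F A K : Type u) [Field F] [Fintype F] [CommRing A] [Algebra F A] [Field K] [Algebra F K]
  [Algebra A K] [IsScalarTower F A K]

/-- The ideal `𝔧`, the kernel of `A ⊗ K → K`, `a ⊗ r ↦ a r`. -/
def idealJ : Ideal (A ⊗[F] K) :=
  RingHom.ker (Algebra.TensorProduct.productMap (IsScalarTower.toAlgHom F A K) (AlgHom.id F K))

/-- An Anderson `A`-motive over `K`: a finite locally free `A ⊗ K`-module `M` together with an
isomorphism `τ_M : (τ^* M)[𝔧⁻¹] ≃ M[𝔧⁻¹]`. -/
structure AMotive where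
  /-- the underlying module -/
  carrier : Type u
  [addCommGroup : AddCommGroup carrier]
  [module : Module (A ⊗[F] K) carrier]
  [finite : Module.Finite (A ⊗[F] K) carrier]
  [projective : Module.Projective (A ⊗[F] K) carrier]
  /-- the isomorphism `τ_M` -/
  τ : InvAlong (idealJ F A K) (Pullback (tensorFrob F A K) carrier) ≃ₗ[A ⊗[F] K]
    InvAlong (idealJ F A K) carrier

attribute [instance] AMotive.addCommGroup AMotive.module AMotive.finite AMotive.projective

namespace AMotive

variable {F A K}

/-- Morphisms of `A`-motives: `A ⊗ K`-linear maps `f` such that `f ∘ τ_M = τ_N ∘ τ^* f`. -/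
@[ext]
structure Hom (M N : AMotive F A K) where
  /-- the underlying linear map -/
  lin : M.carrier →ₗ[A ⊗[F] K] N.carrier
  comm : InvAlong.map (idealJ F A K) lin ∘ₗ M.τ.toLinearMap =
    N.τ.toLinearMap ∘ₗ InvAlong.map (idealJ F A K) (Pullback.map (tensorFrob F A K) lin)

instance : Category (AMotive F A K) where
  Hom := Hom
  id M := ⟨LinearMap.id, by
    rw [Pullback.map_id, InvAlong.map_id, InvAlong.map_id]; rfl⟩
  comp f g := ⟨g.lin ∘ₗ f.lin, by
    rw [Pullback.map_comp, InvAlong.map_comp, InvAlong.map_comp, LinearMap.comp_assoc, f.comm,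
      ← LinearMap.comp_assoc, g.comm, LinearMap.comp_assoc]⟩

variable {M N : AMotive F A K}

theorem hom_ext {f g : M ⟶ N} (h : f.lin = g.lin) : f = g := Hom.ext h

theorem id_lin (M : AMotive F A K) : Hom.lin (𝟙 M) = LinearMap.id := rfl
theorem comp_lin {M N Q : AMotive F A K} (f : M ⟶ N) (g : N ⟶ Q) :
    (f ≫ g).lin = g.lin ∘ₗ f.lin := rfl

/-- The morphisms `M → N` as a subgroup of the group of linear maps. -/
def homSubgroup (M N : AMotive F A K) : AddSubgroup (M.carrier →ₗ[A ⊗[F] K] N.carrier) where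
  carrier := {f | InvAlong.map (idealJ F A K) f ∘ₗ M.τ.toLinearMap =
    N.τ.toLinearMap ∘ₗ InvAlong.map (idealJ F A K) (Pullback.map (tensorFrob F A K) f)}
  zero_mem' := by
    change _ = _
    rw [Pullback.map_zero, InvAlong.map_zero, InvAlong.map_zero, LinearMap.zero_comp,
      LinearMap.comp_zero]
  add_mem' {f g} hf hg := by
    change _ = _ at hf hg ⊢
    rw [Pullback.map_add, InvAlong.map_add, InvAlong.map_add, LinearMap.add_comp,
      LinearMap.comp_add, hf, hg]
  neg_mem' {f} hf := by
    change _ = _ at hf ⊢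
    rw [Pullback.map_neg, InvAlong.map_neg, InvAlong.map_neg, LinearMap.neg_comp,
      LinearMap.comp_neg, hf]

/-- Morphisms as elements of `homSubgroup`. -/
def homEquiv (M N : AMotive F A K) : (M ⟶ N) ≃ homSubgroup M N where
  toFun f := ⟨f.lin, f.comm⟩
  invFun f := ⟨f.1, f.2⟩
  left_inv _ := rfl
  right_inv _ := rfl

instance (M N : AMotive F A K) : AddCommGroup (M ⟶ N) := (homEquiv M N).addCommGroup

theorem add_lin (f g : M ⟶ N) : (f + g).lin = f.lin + g.lin := rfl

instance : Preadditive (AMotive F A K) where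
  add_comp _ _ _ f f' g := hom_ext (LinearMap.comp_add f.lin f'.lin g.lin)
  comp_add _ _ _ f g g' := hom_ext (LinearMap.add_comp f.lin g'.lin g.lin)

end AMotive

end Motive

section Betti

/-! ### Betti realization -/

variable {F A K : Type u} [Field F] [Fintype F] [CommRing A] [Algebra F A] [Field K] [Algebra F K]
  [Algebra A K] [IsScalarTower F A K] (M : AMotive F A K)
  (L : Type u) [NormedField L] [Algebra F L] [Algebra K L] [IsScalarTower F K L]

namespace AMotive

/-- `M ⊗_{A ⊗ K} L⟨A⟩`. -/
abbrev Ext : Type u := Tate F A L ⊗[A ⊗[F] K] M.carrier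

/-- `ω ↦ τ^* ω`, from `M ⊗ L⟨A⟩` to `τ^*(M ⊗ L⟨A⟩) = (τ^* M) ⊗ L⟨A⟩`. -/
def pullExt : M.Ext L →ₛₗ[tensorFrob F A K]
    Tate F A L ⊗[A ⊗[F] K] Pullback (tensorFrob F A K) M.carrier :=
  TensorProduct.map (Tate.frobₛₗ F A L K) (Pullback.mk (tensorFrob F A K) M.carrier)

/-- The map `M ⊗ L⟨A⟩ → M[𝔧⁻¹] ⊗ L⟨A⟩`. It is bijective as soon as `𝔧` generates the unit ideal of
`L⟨A⟩`, for instance for `L = ℂ_∞`. -/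
def toInv : M.Ext L →ₗ[A ⊗[F] K] Tate F A L ⊗[A ⊗[F] K] InvAlong (idealJ F A K) M.carrier :=
  LinearMap.lTensor (Tate F A L) (InvAlong.ι (idealJ F A K) M.carrier)

/-- `τ_M ⊗ id`, as a map `(τ^* M) ⊗ L⟨A⟩ → M[𝔧⁻¹] ⊗ L⟨A⟩`. -/
def τExt : Tate F A L ⊗[A ⊗[F] K] Pullback (tensorFrob F A K) M.carrier →ₗ[A ⊗[F] K]
    Tate F A L ⊗[A ⊗[F] K] InvAlong (idealJ F A K) M.carrier :=
  LinearMap.lTensor (Tate F A L)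
    (M.τ.toLinearMap ∘ₗ InvAlong.ι (idealJ F A K) (Pullback (tensorFrob F A K) M.carrier))

/-- The Betti realization `M_B = {ω ∈ M ⊗ L⟨A⟩ | ω = τ_M(τ^* ω)}`, to be used for `L = ℂ_∞`.
The equation is written in `M[𝔧⁻¹] ⊗ L⟨A⟩`, which is the same module as `M ⊗ L⟨A⟩` when `𝔧` is
invertible in `L⟨A⟩`. -/
def betti : Submodule A (M.Ext L) where
  carrier := {ω | M.toInv L ω = M.τExt L (M.pullExt L ω)}
  zero_mem' := by simp
  add_mem' {x y} hx hy := by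
    change _ = _ at hx hy ⊢
    rw [map_add, map_add, map_add, hx, hy]
  smul_mem' a x hx := by
    change _ = _ at hx ⊢
    have h : tensorFrob F A K (algebraMap A (A ⊗[F] K) a) = algebraMap A (A ⊗[F] K) a := by
      simp [tensorFrob, Algebra.TensorProduct.algebraMap_apply]
    rw [← algebraMap_smul (A ⊗[F] K) a x, map_smul, map_smulₛₗ, map_smul, hx, h]

theorem mem_betti {ω : M.Ext L} : ω ∈ M.betti L ↔ M.toInv L ω = M.τExt L (M.pullExt L ω) :=
  Iff.rfl

/-- `M` is rigid analytically trivial over `L` if multiplication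
`M_B ⊗_A L⟨A⟩ → M ⊗_{A ⊗ K} L⟨A⟩`, `ω ⊗ c ↦ c ω`, is bijective. -/
def IsRigidAnalyticallyTrivial : Prop :=
  Function.Bijective (LinearMap.liftBaseChange (Tate F A L) (M.betti L).subtype)

variable {M} {N : AMotive F A K} {L}

/-- The map `M ⊗ L⟨A⟩ → N ⊗ L⟨A⟩` induced by a morphism. -/
def extMap (L : Type u) [NormedField L] [Algebra F L] [Algebra K L] [IsScalarTower F K L]
    (f : M ⟶ N) : M.Ext L →ₗ[A ⊗[F] K] N.Ext L := LinearMap.lTensor (Tate F A L) f.lin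

theorem pullExt_tmul (s : Tate F A L) (m : M.carrier) :
    M.pullExt L (s ⊗ₜ m) = Tate.frob F A L s ⊗ₜ Pullback.mk (tensorFrob F A K) M.carrier m := rfl

theorem pullExt_extMap (f : M ⟶ N) (ω : M.Ext L) : N.pullExt L (extMap L f ω) =
    LinearMap.lTensor _ (Pullback.map (tensorFrob F A K) f.lin) (M.pullExt L ω) := by
  induction ω using TensorProduct.induction_on with
  | zero => simp
  | add x y hx hy => simp only [map_add, hx, hy]
  | tmul s m =>
    rw [extMap, LinearMap.lTensor_tmul, pullExt_tmul, pullExt_tmul, LinearMap.lTensor_tmul,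
      Pullback.map_mk]

theorem extMap_mem (f : M ⟶ N) {ω : M.Ext L} (hω : ω ∈ M.betti L) :
    extMap L f ω ∈ N.betti L := by
  rw [mem_betti] at hω ⊢
  have h1 : N.toInv L (extMap L f ω) =
      LinearMap.lTensor _ (InvAlong.map (idealJ F A K) f.lin) (M.toInv L ω) := by
    simp only [toInv, extMap, ← LinearMap.comp_apply, ← LinearMap.lTensor_comp]
    congr 2
    ext x
    exact congrArg Subtype.val (InvAlong.map_ι (idealJ F A K) f.lin x).symm
  have h3 (x) : N.τExt L (LinearMap.lTensor _ (Pullback.map (tensorFrob F A K) f.lin) x) =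
      LinearMap.lTensor _ (InvAlong.map (idealJ F A K) f.lin) (M.τExt L x) := by
    simp only [τExt, ← LinearMap.comp_apply, ← LinearMap.lTensor_comp]
    congr 2
    rw [← LinearMap.comp_assoc, f.comm, LinearMap.comp_assoc, LinearMap.comp_assoc]
    congr 1
    ext x
    exact congrArg Subtype.val (InvAlong.map_ι (idealJ F A K) _ x).symm
  rw [h1, pullExt_extMap, h3, hω]

/-- The map `f_B : M_B → N_B` induced by a morphism `f : M ⟶ N`. -/
def bettiMap (L : Type u) [NormedField L] [Algebra F L] [Algebra K L] [IsScalarTower F K L]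
    (f : M ⟶ N) : M.betti L →ₗ[A] N.betti L :=
  ((extMap L f).restrictScalars A).restrict fun _ hω => extMap_mem f hω

variable (M) {L' : Type u} [NormedField L'] [Algebra F L'] [Algebra K L'] [IsScalarTower F K L']

/-- The map `id ⊗ g : M ⊗ L⟨A⟩ → M ⊗ L'⟨A⟩` induced by a continuous `K`-morphism `g : L → L'`. -/
def mapExt (g : L →ₐ[K] L') (hg : Continuous g) : M.Ext L →ₗ[A ⊗[F] K] M.Ext L' :=
  LinearMap.rTensor M.carrier (Tate.mapAlg F A K g hg).toLinearMap

theorem mapExt_tmul (g : L →ₐ[K] L') (hg : Continuous g) (s : Tate F A L) (m : M.carrier) :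
    M.mapExt g hg (s ⊗ₜ m) = Tate.mapAlg F A K g hg s ⊗ₜ m := rfl

theorem pullExt_mapExt (g : L →ₐ[K] L') (hg : Continuous g) (ω : M.Ext L) :
    M.pullExt L' (M.mapExt g hg ω) =
      LinearMap.rTensor _ (Tate.mapAlg F A K g hg).toLinearMap (M.pullExt L ω) := by
  induction ω using TensorProduct.induction_on with
  | zero => simp
  | add x y hx hy => simp only [map_add, hx, hy]
  | tmul s m =>
    rw [mapExt_tmul, pullExt_tmul, pullExt_tmul, LinearMap.rTensor_tmul, ← Tate.mapAlg_frob]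
    rfl

theorem mapExt_mem (g : L →ₐ[K] L') (hg : Continuous g) {ω : M.Ext L} (hω : ω ∈ M.betti L) :
    M.mapExt g hg ω ∈ M.betti L' := by
  rw [mem_betti] at hω ⊢
  have h1 : M.toInv L' (M.mapExt g hg ω) =
      LinearMap.rTensor _ (Tate.mapAlg F A K g hg).toLinearMap (M.toInv L ω) := by
    simp only [toInv, mapExt, ← LinearMap.comp_apply, LinearMap.lTensor_comp_rTensor,
      LinearMap.rTensor_comp_lTensor]
  have h3 (x) : M.τExt L' (LinearMap.rTensor _ (Tate.mapAlg F A K g hg).toLinearMap x) =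
      LinearMap.rTensor _ (Tate.mapAlg F A K g hg).toLinearMap (M.τExt L x) := by
    simp only [τExt, ← LinearMap.comp_apply, LinearMap.lTensor_comp_rTensor,
      LinearMap.rTensor_comp_lTensor]
  rw [h1, pullExt_mapExt, h3, hω]

theorem extMap_mapExt (g : L →ₐ[K] L') (hg : Continuous g) (f : M ⟶ N) (ω : M.Ext L) :
    extMap L' f (M.mapExt g hg ω) = N.mapExt g hg (extMap L f ω) := by
  simp only [extMap, mapExt, ← LinearMap.comp_apply, LinearMap.lTensor_comp_rTensor,
    LinearMap.rTensor_comp_lTensor]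

theorem mapExt_eq_self (g : L →ₐ[K] L) (hg : Continuous g) (h : ∀ c, g c = c) (ω : M.Ext L) :
    M.mapExt g hg ω = ω := by
  have h1 : ∀ s, Tate.mapAlg F A K g hg s = s := fun s =>
    congrFun (Tate.hom_ext (Tate.continuous_mapAlg F A K g hg) continuous_id fun y => by
      induction y using TensorProduct.induction_on with
      | zero => simp
      | add x y hx hy => simp only [map_add, hx, hy, id]
      | tmul a c =>
        rw [Tate.mapAlg_toTate, Algebra.TensorProduct.map_tmul]
        exact congrArg (fun c => toTate F A L (a ⊗ₜ c)) (h c)) s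
  induction ω using TensorProduct.induction_on with
  | zero => simp
  | add x y hx hy => rw [map_add, hx, hy]
  | tmul s m => rw [mapExt_tmul, h1]

theorem mapExt_comp {L'' : Type u} [NormedField L''] [Algebra F L''] [Algebra K L'']
    [IsScalarTower F K L''] (g'' : L →ₐ[K] L'') (hg'' : Continuous g'') (g' : L' →ₐ[K] L'')
    (hg' : Continuous g') (g : L →ₐ[K] L') (hg : Continuous g) (h : ∀ c, g'' c = g' (g c))
    (ω : M.Ext L) : M.mapExt g'' hg'' ω = M.mapExt g' hg' (M.mapExt g hg ω) := by
  have h1 : ∀ s, Tate.mapAlg F A K g'' hg'' s =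
      Tate.mapAlg F A K g' hg' (Tate.mapAlg F A K g hg s) := fun s =>
    congrFun (Tate.hom_ext (g := Tate.mapAlg F A K g' hg' ∘ Tate.mapAlg F A K g hg)
      (Tate.continuous_mapAlg F A K g'' hg'')
      ((Tate.continuous_mapAlg F A K g' hg').comp (Tate.continuous_mapAlg F A K g hg)) fun y => by
      induction y using TensorProduct.induction_on with
      | zero => simp
      | add x y hx hy =>
        rw [map_add, map_add, hx, hy]
        simp only [Function.comp_apply, map_add]
      | tmul a c =>
        rw [Function.comp_apply, Tate.mapAlg_toTate, Tate.mapAlg_toTate, Tate.mapAlg_toTate,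
          Algebra.TensorProduct.map_tmul, Algebra.TensorProduct.map_tmul,
          Algebra.TensorProduct.map_tmul]
        exact congrArg (fun c => toTate F A L'' (a ⊗ₜ c)) (h c)) s
  induction ω using TensorProduct.induction_on with
  | zero => simp
  | add x y hx hy => rw [map_add, map_add, map_add, hx, hy]
  | tmul s m => rw [mapExt_tmul, mapExt_tmul, mapExt_tmul, h1]

/-- The map `M_B(L) → M_B(L')` induced by a continuous `K`-morphism `L → L'`. -/
def bettiChange (g : L →ₐ[K] L') (hg : Continuous g) : M.betti L →ₗ[A] M.betti L' :=
  ((M.mapExt g hg).restrictScalars A).restrict fun _ hω => M.mapExt_mem g hg hω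

end AMotive

end Betti

section Galois

variable {F K : Type u} [Field F] [Fintype F] [Field K] [Algebra F K] (P : ClosedPoint F K)

/-- `A`-motives over `K`, for `A` the ring of functions regular away from `P`. -/
abbrev AMotK : Type (u + 1) := AMotive F P.regularAway K

variable {P}

/-- The action of `G_∞` on the Betti realization, induced by `m ⊗ c ↦ m ⊗ σ(c)`. -/
def bettiRho (M : AMotK P) : Representation P.regularAway (Ginf P) (M.betti (Cinf P)) where
  toFun σ := M.bettiChange ((galCinf P σ).restrictScalars K) (continuous_galCinf P σ)
  map_one' := LinearMap.ext fun ω => Subtype.ext <|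
    AMotive.mapExt_eq_self M _ _ (fun c => galCinf_one P c) ω.1
  map_mul' σ σ' := LinearMap.ext fun ω => Subtype.ext <|
    AMotive.mapExt_comp M _ _ _ _ _ _ (fun c => galCinf_mul P σ σ' c) ω.1

theorem bettiRho_apply (M : AMotK P) (σ : Ginf P) (ω : M.betti (Cinf P)) :
    (bettiRho M σ ω : M.Ext (Cinf P)) =
      M.mapExt ((galCinf P σ).restrictScalars K) (continuous_galCinf P σ) ω := rfl

/-- The morphism of representations `M_B → N_B` induced by a morphism of `A`-motives. -/
def bettiHom {M N : AMotK P} (f : M ⟶ N) : (bettiRho M).IntertwiningMap (bettiRho N) where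
  toLinearMap := AMotive.bettiMap (Cinf P) f
  isIntertwining' σ := LinearMap.ext fun ω => Subtype.ext <|
    AMotive.extMap_mapExt M ((galCinf P σ).restrictScalars K) (continuous_galCinf P σ) f ω.1

variable (P)

/-- The Betti realization as a functor from `A`-motives over `K` to (abstract) `A`-linear
representations of `G_∞`. -/
def bettiFunctor : AMotK P ⥤ Rep.{u} P.regularAway (Ginf P) where
  obj M := Rep.of (bettiRho M)
  map f := Rep.ofHom (bettiHom f)
  map_id M := Rep.hom_ext <| Representation.IntertwiningMap.ext <|
    LinearMap.ext fun (ω : M.betti (Cinf P)) => Subtype.ext <|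
      LinearMap.congr_fun (LinearMap.lTensor_id _ _) ω.1
  map_comp {M _ _} f g := Rep.hom_ext <| Representation.IntertwiningMap.ext <|
    LinearMap.ext fun (ω : M.betti (Cinf P)) => Subtype.ext <|
      LinearMap.congr_fun (LinearMap.lTensor_comp _ g.lin f.lin) ω.1

/-- The full subcategory of rigid analytically trivial `A`-motives. -/
abbrev AMotRat : Type (u + 1) :=
  ObjectProperty.FullSubcategory fun M : AMotK P => M.IsRigidAnalyticallyTrivial (Cinf P)

/-- Representations `V` of a topological group on which the action `G × V → V` is continuous,
`V` being given the discrete topology. -/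
def IsContinuousRep (R G : Type u) [CommRing R] [Group G] [TopologicalSpace G] :
    ObjectProperty (Rep.{u} R G) := fun V =>
  letI : TopologicalSpace V := ⊥
  Continuous fun p : G × V => V.ρ p.1 p.2

/-- The category `Rep_A(G_∞)` of continuous `A`-linear representations of `G_∞`. -/
abbrev ContRep : Type (u + 1) := (IsContinuousRep P.regularAway (Ginf P)).FullSubcategory

end Galois

section Exactness

variable {F K : Type u} [Field F] [Fintype F] [Field K] [Algebra F K] {P : ClosedPoint F K}

/-- `0 → M' → M → M'' → 0` is exact in the category of rigid analytically trivial `A`-motives: the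
underlying sequence of modules is exact. -/
def AMotRat.IsShortExact {M' M M'' : AMotRat P} (f : M' ⟶ M) (g : M ⟶ M'') : Prop :=
  Function.Injective f.hom.lin ∧ Function.Exact f.hom.lin g.hom.lin ∧
    Function.Surjective g.hom.lin

/-- `0 → V' → V → V'' → 0` is exact in the category of continuous representations: the underlying
sequence of modules is exact. -/
def ContRep.IsShortExact {V' V V'' : ContRep P} (f : V' ⟶ V) (g : V ⟶ V'') : Prop :=
  Function.Injective f.hom.hom ∧ Function.Exact f.hom.hom g.hom.hom ∧
    Function.Surjective g.hom.hom

variable (P) in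
/-- The restriction of the Betti realization functor to rigid analytically trivial `A`-motives. -/
def bettiRat : AMotRat P ⥤ Rep.{u} P.regularAway (Ginf P) :=
  ObjectProperty.ι _ ⋙ bettiFunctor P

/-- The Betti realization functor with values in continuous representations, given that the
representations `M_B` are continuous. -/
def bettiCont (hcont : ∀ M : AMotRat P, IsContinuousRep _ _ ((bettiRat P).obj M)) :
    AMotRat P ⥤ ContRep P :=
  ObjectProperty.lift _ (bettiRat P) hcont

end Exactness

end AMot

end

open AMot

/-! Over `ℂ_∞⟨A⟩` the poles of `τ_M` disappear. If `a ∈ A` has a pole at `∞`, then `u = a ⊗ 1 - 1 ⊗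
a` lies in `𝔧`, so a power of `u` clears any given pole along `𝔧`. On the other hand `u = -(1 ⊗ a)(1
- a ⊗ a⁻¹)` is inverted by a geometric series in `L⟨A⟩` for every `L` whose norm extends the
absolute value of `K` at `∞`. If `A` contained no such `a`, all its elements would be constant and
`A ⊗ K` would be a copy of `K`, where there are no poles; this alternative replaces an appeal to
Riemann-Roch (`exists_clearsPoles`). Hence `ω ↦ τ_M(τ^* ω)` is a `τ`-semilinear operator on `M ⊗
ℂ_∞⟨A⟩`, called `frobExt`, and `M_B` consists of its fixed points.

The driving force is that `τ` raises the norms of coefficients to the power `q ≥ 2`. It therefore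
contracts small balls, even when followed by multiplication by a fixed element
(`Tate.mul_frob_mem_ball`).

Field of definition: in coordinates, `ω ∈ M_B` solves `x = Φ τ(x)`, where `Φ` has entries in `L⟨A⟩`
for every `L` containing `K_∞`. If `y` is close to `x`, the iterates of `y ↦ Φ τ(y)` converge to `x`
(`Tate.mem_of_eq_sum_mul_frob`). By density `y` can be chosen with finitely many coefficients, all
in `K_∞^s`; since `L⟨A⟩` is closed in `ℂ_∞⟨A⟩`, `x` is defined over the finite extension they
generate. One extension serves all of `M_B`, because `M_B` is finitely generated: it becomes finite
over `ℂ_∞⟨A⟩`, of which `A` is a direct summand. An open subgroup of `G_∞` then acts trivially on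
`M_B`, which gives continuity.

Exactness: a short exact sequence of motives splits as a sequence of modules, so it stays exact over
`ℂ_∞⟨A⟩`, and passing to kernels of `1 - frobExt` is left exact. The obstruction to surjectivity
lies in the cokernel of this operator on `M' ⊗ ℂ_∞⟨A⟩ ≅ M'_B ⊗ ℂ_∞⟨A⟩`. It vanishes because `1 - τ`
is surjective on `ℂ_∞⟨A⟩` (`Tate.exists_sub_frob_eq`). -/

noncomputable section

namespace AMot

/-! ### Poles of functions on the curve -/

open IsDedekindDomain in
/-- A discrete valuation on a finite separable extension `E` of `F(b)` at which `b` vanishes. -/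
theorem exists_valuation_lt_one {E : Type u} [Field E]
    (A K : Type u) [CommRing A] [IsDedekindDomain A] [Field K] [Algebra A K] [IsFractionRing A K]
    [Algebra K E] [Algebra A E] [IsScalarTower A K E] [FiniteDimensional K E]
    [Algebra.IsSeparable K E] (b : A) (hb : b ≠ 0) (hu : ¬ IsUnit b) :
    ∃ v : Valuation E (WithZero (Multiplicative ℤ)), v (algebraMap A E b) < 1 ∧
      (∀ x : A, v (algebraMap A E x) ≤ 1) := by
  -- Separability enters here: the integral closure of `A` in `E` is Dedekind. The valuation sought
  -- is that of a prime of it lying over a maximal ideal containing `b`.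
  have hD : IsDedekindDomain (integralClosure A E) := integralClosure.isDedekindDomain A K E
  have hFr : IsFractionRing (integralClosure A E) E :=
    IsIntegralClosure.isFractionRing_of_finite_extension A K E _
  have hinj : Function.Injective (algebraMap A E) := by
    rw [IsScalarTower.algebraMap_eq A K E]
    exact (algebraMap K E).injective.comp (IsFractionRing.injective A K)
  have : FaithfulSMul A (integralClosure A E) := by
    rw [faithfulSMul_iff_algebraMap_injective]
    exact Function.Injective.of_comp (f := algebraMap (integralClosure A E) E) hinj
  obtain ⟨n, hn, hbn⟩ := exists_max_ideal_of_mem_nonunits hu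
  obtain ⟨m, hm, hmn⟩ :=
    Ideal.exists_maximal_ideal_liesOver_of_isIntegral (S := integralClosure A E) n
  have hbm : algebraMap A (integralClosure A E) b ∈ m := by
    rwa [← Ideal.mem_comap, ← Ideal.under_def, ← hmn.over]
  have hne : m ≠ ⊥ := by
    rintro rfl
    have : algebraMap A (integralClosure A E) b = 0 := by simpa using hbm
    exact hb (hinj (by
      rw [map_zero]; exact congrArg (algebraMap (integralClosure A E) E) this))
  let v : HeightOneSpectrum (integralClosure A E) := ⟨m, hm.isPrime, hne⟩
  refine ⟨v.valuation E, ?_, fun x => ?_⟩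
  · exact (v.valuation_lt_one_iff_mem (K := E) (algebraMap A (integralClosure A E) b)).2 hbm
  · exact v.valuation_le_one (K := E) (algebraMap A (integralClosure A E) x)

/-- In transcendence degree one, `b` alone is a transcendence basis, so `K` is algebraic over
`F(b)`; being finitely generated, it is finite. -/
theorem finiteDimensional_adjoin_of_transcendental {F K : Type u} [Field F] [Field K] [Algebra F K]
    [IsCurveFunctionField F K] {b : K} (hb : Transcendental F b) :
    FiniteDimensional (IntermediateField.adjoin F {b}) K := by
  have : Algebra.EssFiniteType F K :=
    IntermediateField.fg_top_iff.1 (IsCurveFunctionField.fg (F := F) (K := K))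
  have hess : Algebra.EssFiniteType (IntermediateField.adjoin F {b}) K :=
    Algebra.EssFiniteType.of_comp F _ K
  have hai : AlgebraicIndependent F (fun _ : Unit => b) :=
    (algebraicIndependent_unique_type_iff).2 hb
  have htb : IsTranscendenceBasis F (fun _ : Unit => b) :=
    hai.isTranscendenceBasis_of_lift_trdeg_le_of_finite
      (by simp [IsCurveFunctionField.trdeg_eq_one (F := F) (K := K)])
  have : Algebra.IsAlgebraic (IntermediateField.adjoin F {b}) K := by
    have := htb.isAlgebraic_field
    rwa [Set.range_const] at this
  exact Algebra.finite_of_essFiniteType_of_isAlgebraic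


/-- The valuation ring of a valuation with values in `ℤ` that is nontrivial. -/
theorem isDiscreteValuationRing_of_exists_one_lt {K : Type u} [Field K]
    (w : Valuation K (WithZero (Multiplicative ℤ))) {a : K} (ha : 1 < w a) :
    IsDiscreteValuationRing w.valuationSubring := by
  have hne : w a ≠ 0 := (zero_lt_one.trans ha).ne'
  -- The value group is a subgroup of a cyclic group, and it is nontrivial because of `a`; this is
  -- what characterizes discrete valuation rings among valuation rings.
  have h1 : IsCyclic (WithZero (Multiplicative ℤ))ˣ :=
    isCyclic_of_surjective (WithZero.unitsWithZeroEquiv (α := Multiplicative ℤ)).symm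
      (MulEquiv.surjective _)
  have h2 : Nontrivial (MonoidWithZeroHom.valueGroup (.ofClass w)) := by
    refine ⟨⟨⟨Units.mk0 (w a) hne, MonoidWithZeroHom.mem_valueGroup _ ⟨a, rfl⟩⟩, 1, fun h => ?_⟩⟩
    have := congrArg (fun x : MonoidWithZeroHom.valueGroup (.ofClass w) =>
      ((x : (WithZero (Multiplicative ℤ))ˣ) : WithZero (Multiplicative ℤ))) h
    exact ha.ne' this
  infer_instance

open scoped IntermediateField.algebraAdjoinAdjoin in
/-- Every nonconstant function on the curve has a pole at some closed point. -/
theorem exists_closedPoint_notMem {F K : Type u} [Field F] [Fintype F] [Field K] [Algebra F K]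
    [IsCurveFunctionField F K] {a : K} (ha : Transcendental F a) :
    ∃ Q : ClosedPoint F K, a ∉ Q.localRing := by
  -- A pole of `a` is a zero of `a⁻¹`, to be found above the prime `a⁻¹` of the principal ideal
  -- domain `F[a⁻¹]`.
  have hb : Transcendental F a⁻¹ := fun h => ha (by simpa using h.inv)
  have := finiteDimensional_adjoin_of_transcendental hb
  let A := Algebra.adjoin F {a⁻¹}
  let K₀ := IntermediateField.adjoin F {a⁻¹}
  have hmem (y : A) : ∃ p : Polynomial F, Polynomial.aeval a⁻¹ p = (y : K) := by
    have : (y : K) ∈ Algebra.adjoin F {a⁻¹} := y.2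
    rwa [Algebra.adjoin_singleton_eq_range_aeval] at this
  let b : A := ⟨a⁻¹, Algebra.self_mem_adjoin_singleton F a⁻¹⟩
  have hPID : IsPrincipalIdealRing A := by
    refine IsPrincipalIdealRing.of_surjective (Polynomial.aeval (R := F) b).toRingHom fun y => ?_
    obtain ⟨p, hp⟩ := hmem y
    exact ⟨p, Subtype.ext ((Polynomial.aeval_algebraMap_apply K b p).symm.trans hp)⟩
  let E := separableClosure K₀ K
  have h1 : IsDedekindDomain A := inferInstance
  have h2 : IsFractionRing A K₀ := inferInstance
  have h3 : FiniteDimensional E K := Module.Finite.of_restrictScalars_finite K₀ E K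
  have hb0 : b ≠ 0 := fun h => by
    have h0 : a⁻¹ = 0 := congrArg Subtype.val h
    exact hb (by rw [h0]; exact isAlgebraic_zero)
  have hbu : ¬ IsUnit b := by
    intro h
    obtain ⟨y, hy⟩ := h.exists_right_inv
    obtain ⟨p, hp⟩ := hmem y
    -- An inverse `p(a⁻¹)` of `a⁻¹` would give `X p - 1 = 0`, which is absurd at `X = 0`.
    have h0 : Polynomial.aeval a⁻¹ (Polynomial.X * p - 1) = 0 := by
      rw [map_sub, map_mul, Polynomial.aeval_X, hp, map_one, sub_eq_zero]
      exact congrArg Subtype.val hy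
    have h4 := (transcendental_iff.1 hb) _ h0
    simpa using congrArg (Polynomial.eval 0) h4
  obtain ⟨v, hv, hvA⟩ := exists_valuation_lt_one (E := E) A K₀ b hb0 hbu
  obtain ⟨p, hp⟩ := ExpChar.exists E
  -- `K` need not be separable over `F(a⁻¹)`. It is purely inseparable over `E` of finite exponent,
  -- so `x ↦ x ^ N` maps `K` into `E`, and the valuation of `E` is pulled back along this map.
  let φ : K →+* E := IsPurelyInseparable.iterateFrobenius E K p le_rfl
  let N := p ^ IsPurelyInseparable.exponent E K
  have hN : N ≠ 0 := pow_ne_zero _ (expChar_pos E p).ne'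
  have hφ (x : E) : φ (algebraMap E K x) = x ^ N :=
    IsPurelyInseparable.iterateFrobenius_algebraMap K p le_rfl x
  let w := v.comap φ
  have hwE (x : E) : w (algebraMap E K x) = v x ^ N := by
    rw [← map_pow, ← hφ]; rfl
  have hwa : 1 < w a := by
    have h5 : w a⁻¹ < 1 := by
      rw [show a⁻¹ = algebraMap E K (algebraMap A E b) from rfl, hwE]
      exact pow_lt_one₀ zero_le hv hN
    rw [map_inv₀] at h5
    refine (inv_lt_one_iff₀.1 h5).resolve_left fun h => ?_
    have h6 : a = 0 := by simpa using h
    exact ha (by rw [h6]; exact isAlgebraic_zero)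
  refine ⟨⟨w.valuationSubring, fun c => ?_, isDiscreteValuationRing_of_exists_one_lt w hwa⟩,
    fun h => ?_⟩
  · rw [Valuation.mem_valuationSubring_iff,
      show algebraMap F K c = algebraMap E K (algebraMap A E (algebraMap F A c)) from rfl, hwE]
    exact pow_le_one₀ zero_le (hvA _)
  · exact absurd ((Valuation.mem_valuationSubring_iff _ _).1 h) hwa.not_ge

/-- A function that is regular away from `P` and at `P` is constant. -/
theorem ClosedPoint.mem_range_of_mem {F K : Type u} [Field F] [Fintype F] [Field K] [Algebra F K]
    [IsCurveFunctionField F K] (P : ClosedPoint F K) {a : K} (ha : a ∈ P.regularAway)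
    (haP : a ∈ P.localRing) : a ∈ (algebraMap F K).range := by
  refine IsCurveFunctionField.constants a (isAlgebraic_iff_isIntegral.1 ?_)
  by_contra h
  obtain ⟨Q, hQ⟩ := exists_closedPoint_notMem h
  rcases eq_or_ne Q P with rfl | hne
  · exact hQ haP
  · exact hQ (ha Q hne)

/-- Outside the valuation ring, the inverse of `a` is a nonunit of that ring, hence has absolute
value less than one. -/
theorem ClosedPoint.one_lt_abv {F K : Type u} [Field F] [Fintype F] [Field K] [Algebra F K]
    (P : ClosedPoint F K) {a : K} (ha : a ∉ P.localRing) : 1 < P.abv a := by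
  have := P.isDVR
  have h0 : a ≠ 0 := fun h => ha (h ▸ zero_mem _)
  have hinv : a⁻¹ ∈ P.localRing := (P.localRing.mem_or_inv_mem a).resolve_left ha
  have hnu : (⟨a⁻¹, hinv⟩ : P.localRing) ∈ IsLocalRing.maximalIdeal P.localRing := by
    rw [IsLocalRing.mem_maximalIdeal, mem_nonunits_iff]
    intro h
    obtain ⟨y, hy⟩ := h.exists_right_inv
    have h1 : a⁻¹ * (y : K) = 1 := congrArg Subtype.val hy
    exact ha ((inv_mul_eq_one₀ h0).1 h1 ▸ y.2)
  have h1 : P.abv a⁻¹ < 1 :=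
    (IsDedekindDomain.HeightOneSpectrum.adicAbv_coe_lt_one_iff (K := K) _ _
      (⟨a⁻¹, hinv⟩ : P.localRing)).2 hnu
  rw [map_inv₀] at h1
  exact (inv_lt_one_iff₀.1 h1).resolve_left (P.abv.pos h0).not_ge

/-! ### Topology of the Tate algebras -/

section TateTopology

open Topology UniformSpace

variable (F A L : Type u) [Field F] [CommRing A] [Algebra F A] [NormedField L] [Algebra F L]

instance : NonarchimedeanRing (PreTate F A L) := (PreTate.ringSubgroupsBasis F A L).nonarchimedean

instance : IsTopologicalRing (Tate F A L) :=
  inferInstanceAs (IsTopologicalRing (Completion (PreTate F A L)))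

instance : IsUniformAddGroup (Tate F A L) :=
  inferInstanceAs (IsUniformAddGroup (Completion (PreTate F A L)))

instance : CompleteSpace (Tate F A L) :=
  inferInstanceAs (CompleteSpace (Completion (PreTate F A L)))

instance : NonarchimedeanRing (Tate F A L) :=
  inferInstanceAs (NonarchimedeanRing (Completion (PreTate F A L)))

/-- The closure in `L⟨A⟩` of the image of `A ⊗ {c | ‖c‖ ≤ r}`. -/
def Tate.ball (r : {r : ℝ // 0 < r}) : AddSubgroup (Tate F A L) :=
  AddSubgroup.topologicalClosure
    ((PreTate.ball F A L r).map (UniformSpace.Completion.toCompl : PreTate F A L →+ _))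

variable {F A L}

theorem Tate.toTate_mem_ball {r : {r : ℝ // 0 < r}} {x : A ⊗[F] L}
    (hx : PreTate.of F A L x ∈ PreTate.ball F A L r) : toTate F A L x ∈ Tate.ball F A L r :=
  AddSubgroup.le_topologicalClosure _ ⟨_, hx, rfl⟩

theorem Tate.toTate_tmul_mem_ball {r : {r : ℝ // 0 < r}} (a : A) {c : L} (hc : ‖c‖ ≤ r) :
    toTate F A L (a ⊗ₜ c) ∈ Tate.ball F A L r :=
  Tate.toTate_mem_ball (PreTate.tmul_mem_ball a hc)

theorem Tate.ball_mono {r s : {r : ℝ // 0 < r}} (h : r ≤ s) :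
    Tate.ball F A L r ≤ Tate.ball F A L s :=
  AddSubgroup.topologicalClosure_mono (AddSubgroup.map_mono (PreTate.ball_mono F A L h))

theorem Tate.ball_mem_nhds (r : {r : ℝ // 0 < r}) : (Tate.ball F A L r : Set (Tate F A L)) ∈ 𝓝 0 := by
  have h : (PreTate.ball F A L r : Set (PreTate F A L)) ∈ 𝓝 0 :=
    (PreTate.ringSubgroupsBasis F A L).hasBasis_nhds_zero.mem_of_mem trivial
  exact (Completion.isDenseInducing_coe (α := PreTate F A L)).closure_image_mem_nhds h

/-- Closed neighbourhoods of zero form a basis, and a closed set containing the image of a ball of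
`A ⊗ L` contains its closure. -/
theorem Tate.hasBasis_nhds_zero :
    (𝓝 (0 : Tate F A L)).HasBasis (fun _ => True) fun r => (Tate.ball F A L r : Set (Tate F A L)) := by
  refine ⟨fun U => ⟨fun hU => ?_, fun ⟨r, _, hr⟩ =>
    Filter.mem_of_superset (Tate.ball_mem_nhds r) hr⟩⟩
  obtain ⟨C, ⟨hC, hCc⟩, hCU⟩ := (closed_nhds_basis (0 : Tate F A L)).mem_iff.mp hU
  have hc : Continuous ((↑) : PreTate F A L → Completion (PreTate F A L)) :=
    Completion.continuous_coe _
  have h : ((↑) : PreTate F A L → Completion (PreTate F A L)) ⁻¹' C ∈ 𝓝 0 :=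
    hc.continuousAt.preimage_mem_nhds hC
  obtain ⟨r, -, hr⟩ := (PreTate.ringSubgroupsBasis F A L).hasBasis_nhds_zero.mem_iff.mp h
  exact ⟨r, trivial, (closure_minimal (Set.image_subset_iff.mpr hr) hCc).trans hCU⟩

theorem Tate.mul_mem_ball {r s t : {r : ℝ // 0 < r}} (h : (r : ℝ) * s ≤ t) {x y : Tate F A L}
    (hx : x ∈ Tate.ball F A L r) (hy : y ∈ Tate.ball F A L s) : x * y ∈ Tate.ball F A L t := by
  refine map_mem_closure₂ (f := fun x y : Tate F A L => x * y) continuous_mul hx hy ?_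
  rintro _ ⟨x, hx, rfl⟩ _ ⟨y, hy, rfl⟩
  exact ⟨x * y, PreTate.ball_mul F A L h hx hy, Completion.coe_mul x y⟩

/-- Elements of `L⟨A⟩` are approximated by elements of `A ⊗ L`. -/
theorem Tate.exists_sub_mem_ball (x : Tate F A L) (r : {r : ℝ // 0 < r}) :
    ∃ y : A ⊗[F] L, x - toTate F A L y ∈ Tate.ball F A L r := by
  have h : (fun z => x - z) ⁻¹' (Tate.ball F A L r : Set (Tate F A L)) ∈ 𝓝 x :=
    (continuous_const.sub continuous_id).continuousAt.preimage_mem_nhds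
      (by simpa using Tate.ball_mem_nhds r)
  obtain ⟨y, hy⟩ := (denseRange_toTate F A L).exists_mem_open isOpen_interior
    ⟨x, mem_interior_iff_mem_nhds.2 h⟩
  exact ⟨y, interior_subset (s := (fun z => x - z) ⁻¹' (Tate.ball F A L r : Set (Tate F A L))) hy⟩

theorem Tate.exists_mem_ball (x : Tate F A L) : ∃ r, x ∈ Tate.ball F A L r := by
  obtain ⟨y, hy⟩ := Tate.exists_sub_mem_ball x ⟨1, one_pos⟩
  obtain ⟨s, hs⟩ := PreTate.exists_mem_ball F A L (PreTate.of F A L y)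
  refine ⟨⟨1, one_pos⟩ ⊔ s, ?_⟩
  rw [← sub_add_cancel x (toTate F A L y)]
  exact add_mem (Tate.ball_mono le_sup_left hy)
    (Tate.ball_mono le_sup_right (Tate.toTate_mem_ball hs))

variable [Fintype F]

/-- By continuity this is checked on `a ⊗ c`, where it is `‖c ^ q‖ = ‖c‖ ^ q`. -/
theorem Tate.frob_mem_ball {r s : {r : ℝ // 0 < r}} (h : (r : ℝ) ^ Fintype.card F ≤ s)
    {x : Tate F A L} (hx : x ∈ Tate.ball F A L r) : Tate.frob F A L x ∈ Tate.ball F A L s := by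
  refine map_mem_closure (Tate.continuous_frob F A L) hx ?_
  rintro _ ⟨x, hx, rfl⟩
  refine ⟨PreTate.map F A (FiniteField.frobeniusAlgHom F L) x, ?_,
    (Completion.mapRingHom_coe (PreTate.continuous_map F A _ (continuous_frobeniusAlgHom L))
      x).symm⟩
  induction hx using AddSubgroup.closure_induction with
  | zero => rw [map_zero]; exact zero_mem _
  | add x y _ _ h1 h2 => rw [map_add]; exact add_mem h1 h2
  | neg x _ h1 => rw [map_neg]; exact neg_mem h1
  | mem x hx =>
    obtain ⟨a, c, hc, rfl⟩ := hx
    rw [PreTate.map_of, Algebra.TensorProduct.map_tmul]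
    refine PreTate.tmul_mem_ball _ ?_
    change ‖c ^ Fintype.card F‖ ≤ s
    rw [norm_pow]
    exact (pow_le_pow_left₀ (norm_nonneg _) hc _).trans h

/-- From `f ^ q = f` the norm of `f` satisfies `t ^ q = t`, which excludes `t > 1`. Thus balls of
`L` are stable under `F`. -/
theorem norm_smul_le_of_finite (f : F) (c : L) : ‖f • c‖ ≤ ‖c‖ := by
  rw [Algebra.smul_def, norm_mul]
  refine mul_le_of_le_one_left (norm_nonneg _) ?_
  by_contra! h
  have h1 := congrArg (fun x => ‖algebraMap F L x‖) (FiniteField.pow_card f)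
  simp only [map_pow, norm_pow] at h1
  exact (lt_self_pow₀ h Fintype.one_lt_card).ne' h1

variable [IsUltrametricDist L]

/-- Membership in `A ⊗ {c | ‖c‖ ≤ r}` is read off from the coordinates in a basis of `A`. -/
theorem PreTate.mem_ball_iff {ι : Type*} [DecidableEq ι] (e : Module.Basis ι F A) (r : {r : ℝ // 0 < r})
    (x : A ⊗[F] L) : PreTate.of F A L x ∈ PreTate.ball F A L r ↔
      ∀ i, ‖TensorProduct.equivFinsuppOfBasisLeft e x i‖ ≤ r := by
  constructor
  · intro hx
    obtain ⟨y, hy, hyx⟩ : ∃ y ∈ PreTate.ball F A L r, (PreTate.of F A L).symm y = x := ⟨_, hx, rfl⟩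
    clear hx
    subst hyx
    induction hy using AddSubgroup.closure_induction with
    | zero => simp [r.2.le]
    | add x y _ _ h1 h2 =>
      intro i
      rw [map_add, map_add, Finsupp.add_apply]
      exact (IsUltrametricDist.norm_add_le_max _ _).trans (max_le (h1 i) (h2 i))
    | neg x _ h1 =>
      intro i
      rw [map_neg, map_neg, Finsupp.neg_apply, norm_neg]
      exact h1 i
    | mem x hx =>
      obtain ⟨a, c, hc, rfl⟩ := hx
      intro i
      rw [RingEquiv.symm_apply_apply, TensorProduct.equivFinsuppOfBasisLeft_apply_tmul_apply]
      exact (norm_smul_le_of_finite _ _).trans hc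
  · intro h
    rw [← (TensorProduct.equivFinsuppOfBasisLeft (N := L) e).symm_apply_apply x,
      TensorProduct.equivFinsuppOfBasisLeft_symm_apply, Finsupp.sum, map_sum]
    exact sum_mem fun i _ => PreTate.tmul_mem_ball _ (h i)

variable {L' : Type u} [NormedField L'] [Algebra F L'] [IsUltrametricDist L']

/-- Coordinates in a basis of `A` over `F` commute with `id ⊗ g`, so an isometry `g` makes `A ⊗ L` a
topological subgroup of `A ⊗ L'`. -/
theorem PreTate.map_mem_ball_iff (g : L →ₐ[F] L') (hg : ∀ c, ‖g c‖ = ‖c‖) (r : {r : ℝ // 0 < r})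
    (x : PreTate F A L) :
    PreTate.map F A g x ∈ PreTate.ball F A L' r ↔ x ∈ PreTate.ball F A L r := by
  obtain ⟨x, rfl⟩ := (PreTate.of F A L).surjective x
  classical
  let e := Module.Basis.ofVectorSpace F A
  rw [PreTate.map_of, PreTate.mem_ball_iff e, PreTate.mem_ball_iff e]
  have h (i) : TensorProduct.equivFinsuppOfBasisLeft e
      (Algebra.TensorProduct.map (AlgHom.id F A) g x) i =
        g (TensorProduct.equivFinsuppOfBasisLeft e x i) := by
    induction x using TensorProduct.induction_on with
    | zero => simp
    | add x y hx hy => simp only [map_add, Finsupp.add_apply, hx, hy]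
    | tmul a c => simp
  simp only [h, hg]

/-- The map on completions is again uniformly inducing, so its range is complete, hence closed. -/
theorem Tate.isClosed_range_map (g : L →ₐ[F] L') (hg : ∀ c, ‖g c‖ = ‖c‖) (hc : Continuous g) :
    IsClosed (Set.range (Tate.map F A g hc)) := by
  have h1 : IsUniformInducing (PreTate.map F A g) := by
    refine AddMonoidHom.isUniformInducing_of_isInducing (f := PreTate.map F A g) ?_
    rw [IsTopologicalAddGroup.isInducing_iff_nhds_zero]
    refine (PreTate.ringSubgroupsBasis F A L).hasBasis_nhds_zero.eq_of_same_basis ?_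
    have := ((PreTate.ringSubgroupsBasis F A L').hasBasis_nhds_zero).comap (PreTate.map F A g)
    refine this.congr (fun _ => Iff.rfl) fun r _ => ?_
    ext x
    exact PreTate.map_mem_ball_iff g hg r x
  have h2 : IsUniformInducing (Tate.map F A g hc) :=
    Completion.isUniformInducing_extension ((Completion.isUniformInducing_coe _).comp h1)
  exact h2.isComplete_range.isClosed

theorem Tate.isClosed_range_mapAlg {K : Type u} [Field K] [Algebra F K] [Algebra K L]
    [IsScalarTower F K L] [Algebra K L'] [IsScalarTower F K L'] (g : L →ₐ[K] L')
    (hg : ∀ c, ‖g c‖ = ‖c‖) (hc : Continuous g) :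
    IsClosed (((Tate.mapAlg F A K g hc).range : Subalgebra _ (Tate F A L')) : Set (Tate F A L')) :=
  Tate.isClosed_range_map (g.restrictScalars F) hg hc

end TateTopology

/-! ### Modules of sections with poles along an invertible element -/

section Inverting

variable {R : Type u} [CommRing R] {T : Type u} [CommRing T] [Algebra R T]
  {N N' : Type u} [AddCommGroup N] [Module R N] [AddCommGroup N']
  [Module R N'] {i : N →ₗ[R] N'} {u : R} {v : T}

theorem pow_tmul_eq (huv : algebraMap R T u * v = 1) (n k : ℕ) (m : N) :
    (v ^ n) ⊗ₜ[R] m = (v ^ (n + k)) ⊗ₜ[R] (u ^ k • m) := by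
  rw [← TensorProduct.smul_tmul, Algebra.smul_def, map_pow, pow_add, mul_left_comm, ← mul_pow,
    huv, one_pow, mul_one]

/-- Both sides stand for `1 ⊗ z` written with a denominator; the lemma makes the inverse map below
independent of the denominator chosen. -/
theorem tmul_eq_tmul_of_pow_smul (hi : Function.Injective i) (huv : algebraMap R T u * v = 1)
    {z : N'} {n k : ℕ} {m m' : N} (h : u ^ n • z = i m) (h' : u ^ k • z = i m') :
    (v ^ n) ⊗ₜ[R] m = (v ^ k) ⊗ₜ[R] m' := by
  have h1 : u ^ k • m = u ^ n • m' := hi (by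
    rw [map_smul, map_smul, ← h, ← h', smul_smul, smul_smul, mul_comm])
  rw [pow_tmul_eq huv n k, pow_tmul_eq huv k n, h1, add_comm]

/-- If `u` is invertible in `T` and `N'` is contained in `N[u⁻¹]`, then `T ⊗ N = T ⊗ N'`. -/
theorem bijective_lTensor_of_pow_smul (hi : Function.Injective i)
    (huv : algebraMap R T u * v = 1) (hu : ∀ z : N', ∃ n : ℕ, ∃ m : N, u ^ n • z = i m) :
    Function.Bijective (LinearMap.lTensor T i) := by
  choose n m hnm using hu
  -- The inverse sends `z = u ^ (-n) m` to `v ^ n ⊗ m`.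
  let r : N' →ₗ[R] T ⊗[R] N :=
    { toFun z := (v ^ n z) ⊗ₜ m z
      map_add' z z' := by
        rw [pow_tmul_eq huv (n z) (n z'), pow_tmul_eq huv (n z') (n z), add_comm (n z') (n z),
          ← TensorProduct.tmul_add]
        refine tmul_eq_tmul_of_pow_smul hi huv (hnm _) ?_
        rw [map_add, map_smul, map_smul, ← hnm, ← hnm, smul_smul, smul_smul, smul_add, pow_add,
          mul_comm (u ^ n z')]
      map_smul' a z := by
        rw [RingHom.id_apply, ← TensorProduct.tmul_smul]
        refine tmul_eq_tmul_of_pow_smul hi huv (hnm _) ?_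
        rw [map_smul, ← hnm, smul_comm] }
  have hr (x : N) : r (i x) = 1 ⊗ₜ x := by
    have := tmul_eq_tmul_of_pow_smul (n := n (i x)) (k := 0) hi huv (hnm (i x)) (m' := x) (by simp)
    rw [pow_zero] at this
    exact this
  let ρ : T ⊗[R] N' →ₗ[T] T ⊗[R] N := LinearMap.liftBaseChange T r
  have hρ (s : T) (z : N') : ρ (s ⊗ₜ z) = s • r z := LinearMap.liftBaseChange_tmul ..
  refine Function.bijective_iff_has_inverse.2 ⟨ρ, fun x => ?_, fun x => ?_⟩
  · induction x using TensorProduct.induction_on with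
    | zero => simp
    | add x y hx hy => rw [map_add, map_add, hx, hy]
    | tmul s x =>
      rw [LinearMap.lTensor_tmul, hρ, hr, TensorProduct.smul_tmul', smul_eq_mul, mul_one]
  · induction x using TensorProduct.induction_on with
    | zero => simp
    | add x y hx hy => rw [map_add, map_add, hx, hy]
    | tmul s z =>
      rw [hρ, show r z = (v ^ n z) ⊗ₜ m z from rfl, TensorProduct.smul_tmul',
        LinearMap.lTensor_tmul, ← hnm, ← TensorProduct.smul_tmul, Algebra.smul_def, map_pow,
        smul_eq_mul, mul_left_comm, ← mul_pow, huv, one_pow, mul_one]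

/-- A projective module embeds in a free one, on which nonzerodivisors act injectively. -/
theorem mkLinearMap_injective_of_projective [Module.Projective R N] :
    Function.Injective (LocalizedModule.mkLinearMap R⁰ N) := by
  intro x y h
  obtain ⟨c, hc⟩ := (IsLocalizedModule.eq_iff_exists R⁰ (LocalizedModule.mkLinearMap R⁰ N)).1 h
  obtain ⟨s, hs⟩ := (Module.projective_def'.1 (inferInstance : Module.Projective R N))
  have hs' : Function.LeftInverse (Finsupp.linearCombination R id) s := fun x => LinearMap.congr_fun hs x
  refine hs'.injective (Finsupp.ext fun k => ?_)
  have h1 : (c : R) • s x = (c : R) • s y := by rw [← map_smul, ← map_smul]; exact congrArg s hc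
  have h2 := DFunLike.congr_fun h1 k
  rw [Finsupp.smul_apply, Finsupp.smul_apply, smul_eq_mul, smul_eq_mul] at h2
  exact (mul_cancel_left_mem_nonZeroDivisors c.2).1 h2

theorem InvAlong.ι_injective (j : Ideal R) [Module.Projective R N] :
    Function.Injective (InvAlong.ι j N) :=
  fun _ _ h => mkLinearMap_injective_of_projective (congrArg Subtype.val h)

end Inverting

/-! ### The semilinear operator whose fixed points are the Betti realization -/

section FrobExt

variable {F A K : Type u} [Field F] [Fintype F] [CommRing A] [Algebra F A] [Field K] [Algebra F K]
  [Algebra A K] [IsScalarTower F A K] (M : AMotive F A K)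
  (L : Type u) [NormedField L] [Algebra F L] [Algebra K L] [IsScalarTower F K L]

variable (F A K) in
/-- Some power of `u` clears the denominators of every section with poles along `𝔧`. -/
def ClearsPoles (u : A ⊗[F] K) : Prop :=
  ∀ (N : Type u) [AddCommGroup N] [Module (A ⊗[F] K) N] (z : InvAlong (idealJ F A K) N),
    ∃ n : ℕ, ∃ m : N, u ^ n • z = InvAlong.ι (idealJ F A K) N m

namespace AMotive

theorem bijective_toInv {u : A ⊗[F] K} (hu : ClearsPoles F A K u) {v : Tate F A L}
    (huv : algebraMap _ (Tate F A L) u * v = 1) : Function.Bijective (M.toInv L) :=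
  bijective_lTensor_of_pow_smul (InvAlong.ι_injective _) huv (hu M.carrier)

theorem toInv_smul (s : Tate F A L) (x : M.Ext L) : M.toInv L (s • x) = s • M.toInv L x :=
  map_smul (LinearMap.baseChange (Tate F A L) (InvAlong.ι (idealJ F A K) M.carrier)) s x

theorem τExt_smul (s : Tate F A L)
    (x : Tate F A L ⊗[A ⊗[F] K] Pullback (tensorFrob F A K) M.carrier) :
    M.τExt L (s • x) = s • M.τExt L x :=
  map_smul (LinearMap.baseChange (Tate F A L)
    (M.τ.toLinearMap ∘ₗ InvAlong.ι (idealJ F A K) (Pullback (tensorFrob F A K) M.carrier))) s x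

theorem pullExt_smul (s : Tate F A L) (x : M.Ext L) :
    M.pullExt L (s • x) = Tate.frob F A L s • M.pullExt L x := by
  induction x using TensorProduct.induction_on with
  | zero => simp
  | add x y hx hy => rw [smul_add, map_add, map_add, hx, hy, smul_add]
  | tmul t m =>
    rw [TensorProduct.smul_tmul', pullExt_tmul, pullExt_tmul, TensorProduct.smul_tmul',
      smul_eq_mul, smul_eq_mul, map_mul]

variable {M L}

/-- The `τ`-semilinear operator `ω ↦ τ_M (τ^* ω)` on `M ⊗ L⟨A⟩`. -/
def frobExt (hb : Function.Bijective (M.toInv L)) : M.Ext L →+ M.Ext L :=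
  ((LinearEquiv.ofBijective _ hb).symm.toLinearMap ∘ₗ M.τExt L).toAddMonoidHom.comp
    (M.pullExt L).toAddMonoidHom

theorem toInv_frobExt (hb : Function.Bijective (M.toInv L)) (x : M.Ext L) :
    M.toInv L (frobExt hb x) = M.τExt L (M.pullExt L x) :=
  (LinearEquiv.ofBijective _ hb).apply_symm_apply (M.τExt L (M.pullExt L x))

theorem frobExt_smul (hb : Function.Bijective (M.toInv L)) (s : Tate F A L) (x : M.Ext L) :
    frobExt hb (s • x) = Tate.frob F A L s • frobExt hb x :=
  hb.1 (by rw [toInv_frobExt, pullExt_smul, τExt_smul, toInv_smul, toInv_frobExt])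

theorem mem_betti_iff_frobExt (hb : Function.Bijective (M.toInv L)) {x : M.Ext L} :
    x ∈ M.betti L ↔ frobExt hb x = x := by
  rw [mem_betti, ← toInv_frobExt hb, hb.1.eq_iff, eq_comm]

variable {N : AMotive F A K}

theorem toInv_extMap (f : M ⟶ N) (x : M.Ext L) : N.toInv L (extMap L f x) =
    LinearMap.lTensor _ (InvAlong.map (idealJ F A K) f.lin) (M.toInv L x) := by
  simp only [toInv, extMap, ← LinearMap.comp_apply, ← LinearMap.lTensor_comp]
  congr 2
  ext x
  exact congrArg Subtype.val (InvAlong.map_ι (idealJ F A K) f.lin x).symm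

theorem τExt_lTensor (f : M ⟶ N)
    (x : Tate F A L ⊗[A ⊗[F] K] Pullback (tensorFrob F A K) M.carrier) :
    N.τExt L (LinearMap.lTensor _ (Pullback.map (tensorFrob F A K) f.lin) x) =
      LinearMap.lTensor _ (InvAlong.map (idealJ F A K) f.lin) (M.τExt L x) := by
  simp only [τExt, ← LinearMap.comp_apply, ← LinearMap.lTensor_comp]
  congr 2
  rw [← LinearMap.comp_assoc, f.comm, LinearMap.comp_assoc, LinearMap.comp_assoc]
  congr 1
  ext x
  exact congrArg Subtype.val (InvAlong.map_ι (idealJ F A K) _ x).symm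

theorem extMap_frobExt (hM : Function.Bijective (M.toInv L)) (hN : Function.Bijective (N.toInv L))
    (f : M ⟶ N) (x : M.Ext L) : extMap L f (frobExt hM x) = frobExt hN (extMap L f x) :=
  hN.1 (by rw [toInv_extMap, toInv_frobExt, toInv_frobExt, pullExt_extMap, τExt_lTensor])

/-- Since the quotient is projective, the sequence splits, and a retraction survives the tensor
product; flatness of `L⟨A⟩` is not required. -/
theorem injective_extMap {Q : AMotive F A K} (f : M ⟶ N) (g : N ⟶ Q)
    (hf : Function.Injective f.lin) (hfg : Function.Exact f.lin g.lin)
    (hg : Function.Surjective g.lin) : Function.Injective (extMap L f) := by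
  obtain ⟨s, hs⟩ := Module.projective_lifting_property g.lin LinearMap.id hg
  have h := (hfg.split_tfae hf hg).out 0 1
  obtain ⟨r, hr⟩ := h.1 ⟨s, hs⟩
  refine Function.LeftInverse.injective (g := LinearMap.lTensor (Tate F A L) r) fun x => ?_
  rw [extMap, ← LinearMap.comp_apply, ← LinearMap.lTensor_comp, hr, LinearMap.lTensor_id]
  rfl

theorem exact_extMap {Q : AMotive F A K} (f : M ⟶ N) (g : N ⟶ Q)
    (hfg : Function.Exact f.lin g.lin) (hg : Function.Surjective g.lin) :
    Function.Exact (extMap L f) (extMap L g) :=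
  lTensor_exact (Tate F A L) hfg hg

theorem surjective_extMap {Q : AMotive F A K} (g : N ⟶ Q) (hg : Function.Surjective g.lin) :
    Function.Surjective (extMap L g) :=
  LinearMap.lTensor_surjective (Tate F A L) hg

end AMotive
end FrobExt

/-! ### Convergent series and the contraction property of `τ` -/

section Series

open Topology Filter

variable {F A L : Type u} [Field F] [CommRing A] [Algebra F A] [NormedField L] [Algebra F L]

theorem Tate.tendsto_zero_of_mem_ball {x : ℕ → Tate F A L} {r : ℕ → {r : ℝ // 0 < r}}
    (hx : ∀ k, x k ∈ Tate.ball F A L (r k)) (hr : Tendsto (fun k => (r k : ℝ)) atTop (𝓝 0)) :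
    Tendsto x atTop (𝓝 0) := by
  refine Tate.hasBasis_nhds_zero.tendsto_right_iff.2 fun s _ => ?_
  filter_upwards [hr.eventually_lt_const s.2] with k hk
  exact Tate.ball_mono (show r k ≤ s from hk.le) (hx k)

/-- In a complete nonarchimedean group a series converges once its terms tend to zero. -/
theorem Tate.summable_of_mem_ball {x : ℕ → Tate F A L} {r : ℕ → {r : ℝ // 0 < r}}
    (hx : ∀ k, x k ∈ Tate.ball F A L (r k)) (hr : Tendsto (fun k => (r k : ℝ)) atTop (𝓝 0)) :
    Summable x :=
  NonarchimedeanAddGroup.summable_of_tendsto_cofinite_zero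
    (Nat.cofinite_eq_atTop ▸ Tate.tendsto_zero_of_mem_ball hx hr)

theorem tendsto_half_pow_mul (r : ℝ) : Tendsto (fun k : ℕ => r * (1 / 2) ^ k) atTop (𝓝 0) := by
  simpa using (tendsto_pow_atTop_nhds_zero_of_lt_one (r := (1 / 2 : ℝ)) (by norm_num)
    (by norm_num)).const_mul r

/-- `1 - w` is invertible for `w` in a ball of radius less than one. -/
theorem Tate.exists_one_sub_mul_eq_one {w : Tate F A L} {r : {r : ℝ // 0 < r}} (hr : (r : ℝ) < 1)
    (hw : w ∈ Tate.ball F A L r) : ∃ v, (1 - w) * v = 1 := by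
  have h1 (k : ℕ) : w ^ (k + 1) ∈ Tate.ball F A L ⟨r ^ (k + 1), pow_pos r.2 _⟩ := by
    induction k with
    | zero => simpa using hw
    | succ k ih =>
      rw [pow_succ w]
      exact Tate.mul_mem_ball (pow_succ _ _).ge ih hw
  have h2 : Tendsto (fun k : ℕ => (r : ℝ) ^ (k + 1)) atTop (𝓝 0) :=
    (tendsto_pow_atTop_nhds_zero_of_lt_one r.2.le hr).comp (tendsto_add_atTop_nat 1)
  have h3 : Summable fun k : ℕ => w ^ k :=
    (summable_nat_add_iff 1).1 (Tate.summable_of_mem_ball h1 h2)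
  refine ⟨∑' k : ℕ, w ^ k, ?_⟩
  rw [sub_mul, one_mul, ← h3.tsum_mul_left]
  conv_lhs => rw [h3.tsum_eq_zero_add]
  simp only [pow_succ', pow_zero, add_sub_cancel_right]

/-- `a ⊗ 1 - 1 ⊗ a` is invertible in `L⟨A⟩` if `a` has absolute value greater than one in `L`. -/
theorem Tate.exists_mul_eq_one {K : Type u} [Field K] [Algebra F K] [Algebra K L]
    [IsScalarTower F K L] [Algebra A K] [IsScalarTower F A K] {a : A}
    (ha : 1 < ‖algebraMap K L (algebraMap A K a)‖) : ∃ v : Tate F A L,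
      algebraMap (A ⊗[F] K) (Tate F A L) (a ⊗ₜ 1 - 1 ⊗ₜ algebraMap A K a) * v = 1 := by
  set α := algebraMap K L (algebraMap A K a) with hα
  have hα0 : α ≠ 0 := norm_pos_iff.1 (zero_lt_one.trans ha)
  have h1 : ‖α⁻¹‖ < 1 := by rw [norm_inv]; exact inv_lt_one_of_one_lt₀ ha
  -- The factorization is `a ⊗ 1 - 1 ⊗ α = -(1 ⊗ α)(1 - a ⊗ α⁻¹)`. The second factor is inverted by
  -- a geometric series, since `a ⊗ α⁻¹` has radius `‖α⁻¹‖ < 1` whatever `a` is.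
  obtain ⟨v, hv⟩ := Tate.exists_one_sub_mul_eq_one
    (w := toTate F A L (a ⊗ₜ α⁻¹)) (r := ⟨‖α⁻¹‖, norm_pos_iff.2 (inv_ne_zero hα0)⟩) h1
    (Tate.toTate_tmul_mem_ball a le_rfl)
  refine ⟨-toTate F A L (1 ⊗ₜ α⁻¹) * v, ?_⟩
  rw [← hv, ← mul_assoc]
  congr 1
  rw [map_sub, Tate.algebraMap_tmul, Tate.algebraMap_tmul, ← hα, ← map_sub, ← map_neg, ← map_mul,
    map_one, mul_neg, sub_mul, Algebra.TensorProduct.tmul_mul_tmul,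
    Algebra.TensorProduct.tmul_mul_tmul, mul_inv_cancel₀ hα0, mul_one, mul_one, one_mul, neg_sub,
    map_sub]
  rfl

variable [Fintype F]

/-- As `q ≥ 2` and `r ≤ 1`, `τ` shrinks radius `r` to `r ^ 2`; multiplying by `φ` costs a factor
`s`, and `s r ≤ 1 / 2` leaves a net gain of one half at each step. -/
theorem Tate.mul_frob_mem_ball {φ x : Tate F A L} {s r r' : {r : ℝ // 0 < r}}
    (hφ : φ ∈ Tate.ball F A L s) (hx : x ∈ Tate.ball F A L r) (hr1 : (r : ℝ) ≤ 1)
    (hsr : (s : ℝ) * r ≤ 1 / 2) (hr' : (r : ℝ) * (1 / 2) ≤ r') :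
    φ * Tate.frob F A L x ∈ Tate.ball F A L r' := by
  have h1 : (r : ℝ) ^ Fintype.card F ≤ r ^ 2 :=
    pow_le_pow_of_le_one r.2.le hr1 Fintype.one_lt_card
  refine Tate.mul_mem_ball (s := ⟨r ^ 2, pow_pos r.2 2⟩) ?_ hφ (Tate.frob_mem_ball h1 hx)
  calc (s : ℝ) * r ^ 2 = r * (s * r) := by ring
    _ ≤ r * (1 / 2) := by gcongr; exact r.2.le
    _ ≤ r' := hr'

/-- `1 - τ` is surjective on a small ball. -/
theorem Tate.exists_sub_frob_eq_of_mem_ball {y : Tate F A L}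
    (hy : y ∈ Tate.ball F A L ⟨1 / 2, by norm_num⟩) : ∃ x, x - Tate.frob F A L x = y := by
  have h1 (k : ℕ) : (Tate.frob F A L)^[k] y ∈
      Tate.ball F A L ⟨1 / 2 * (1 / 2) ^ k, by positivity⟩ := by
    induction k with
    | zero => simpa using hy
    | succ k ih =>
      rw [Function.iterate_succ_apply', ← one_mul (Tate.frob F A L _)]
      have hk : (1 / 2 : ℝ) ^ k ≤ 1 := pow_le_one₀ (by norm_num) (by norm_num)
      refine Tate.mul_frob_mem_ball (s := ⟨1, one_pos⟩) ?_ ih ?_ ?_ ?_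
      · rw [← map_one (toTate F A L)]
        exact Tate.toTate_tmul_mem_ball 1 (by simp)
      · change 1 / 2 * (1 / 2 : ℝ) ^ k ≤ 1
        linarith
      · change 1 * (1 / 2 * (1 / 2 : ℝ) ^ k) ≤ 1 / 2
        linarith
      · exact (by ring : (1 / 2 * (1 / 2 : ℝ) ^ k) * (1 / 2) = 1 / 2 * (1 / 2) ^ (k + 1)).le
  have h2 := Tate.summable_of_mem_ball h1 (tendsto_half_pow_mul (1 / 2))
  -- The solution is `y + τ(y) + τ²(y) + ⋯`, which telescopes under `1 - τ`.
  refine ⟨∑' k : ℕ, (Tate.frob F A L)^[k] y, ?_⟩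
  rw [h2.map_tsum (Tate.frob F A L) (Tate.continuous_frob F A L)]
  conv_lhs => rw [h2.tsum_eq_zero_add]
  simp only [Function.iterate_succ_apply', Function.iterate_zero, id, add_sub_cancel_right]

end Series

/-! ### The field `ℂ_∞` and the surjectivity of `1 - τ` -/

section Cinf

variable {F K : Type u} [Field F] [Fintype F] [Field K] [Algebra F K] (P : ClosedPoint F K)

instance : IsUltrametricDist (KinfSep P) :=
  IsUltrametricDist.isUltrametricDist_of_forall_norm_add_le_max_norm
    (isNonarchimedean_spectralNorm (K := Kinf P) (L := KinfSep P))

theorem norm_toCinf (x : KinfSep P) : ‖toCinf P x‖ = ‖x‖ :=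
  UniformSpace.Completion.norm_coe (E := KinfSep P) x

instance : IsUltrametricDist (Cinf P) := by
  refine IsUltrametricDist.isUltrametricDist_of_forall_norm_add_le_max_norm fun x y => ?_
  refine UniformSpace.Completion.induction_on₂ (α := KinfSep P) (β := KinfSep P)
    (p := fun x y : Cinf P => ‖x + y‖ ≤ max ‖x‖ ‖y‖) x y ?_ fun a b => ?_
  · exact isClosed_le ((continuous_fst.add continuous_snd).norm)
      (continuous_fst.norm.max continuous_snd.norm)
  · have h := IsUltrametricDist.norm_add_le_max a b
    rw [← norm_toCinf, ← norm_toCinf, ← norm_toCinf, map_add] at h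
    exact h

theorem norm_algebraMap_Kinf_Cinf (x : Kinf P) : ‖algebraMap (Kinf P) (Cinf P) x‖ = ‖x‖ :=
  (norm_toCinf P _).trans (spectralNorm_extends x)

theorem norm_algebraMap_Cinf (k : K) : ‖algebraMap K (Cinf P) k‖ = P.abv k :=
  (norm_algebraMap_Kinf_Cinf P _).trans (norm_toKinf P k)

/-- Artin-Schreier equations are solvable in `K_∞^s`. -/
theorem exists_sub_pow_card_eq (c : KinfSep P) : ∃ d : KinfSep P, d - d ^ Fintype.card F = c := by
  have hsc : IsSepClosed (KinfSep P) := IsSepClosure.sep_closed (Kinf P)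
  have hq : 1 < Fintype.card F := Fintype.one_lt_card
  have hcast : ((Fintype.card F : ℕ) : KinfSep P) = 0 := by
    have h : ((Fintype.card F : ℕ) : F) = 0 := Nat.cast_card_eq_zero F
    rw [← map_natCast ((algebraMap (Kinf P) (KinfSep P)).comp (algebraMap F (Kinf P))), h, map_zero]
  let p : Polynomial (KinfSep P) :=
    Polynomial.X ^ Fintype.card F + (-Polynomial.X + Polynomial.C c)
  have hlt : (-Polynomial.X + Polynomial.C c : Polynomial (KinfSep P)).degree <
      (Fintype.card F : ℕ) := by
    refine lt_of_le_of_lt (b := (1 : WithBot ℕ)) ?_ (by exact_mod_cast hq)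
    refine (Polynomial.degree_add_le _ _).trans (max_le ?_ ?_)
    · rw [Polynomial.degree_neg, Polynomial.degree_X]
    · exact Polynomial.degree_C_le.trans zero_le_one
  have hdeg : p.degree ≠ 0 := by
    rw [Polynomial.degree_add_eq_left_of_degree_lt (by rwa [Polynomial.degree_X_pow]),
      Polynomial.degree_X_pow]
    exact_mod_cast (zero_lt_one.trans hq).ne'
  -- Since `q = 0` in characteristic `p`, the derivative of `X ^ q - X + c` is a unit, so the
  -- polynomial is separable and has a root in `K_∞^s`.
  have hder : p.derivative = -1 := by
    simp [p, Polynomial.derivative_X_pow, hcast]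
  have hsep : p.Separable := by
    rw [Polynomial.separable_def, hder]
    exact isCoprime_one_right.neg_right
  obtain ⟨d, hd⟩ := IsSepClosed.exists_root p hdeg hsep
  refine ⟨d, ?_⟩
  have : d ^ Fintype.card F + (-d + c) = 0 := by simpa [p, Polynomial.IsRoot] using hd
  linear_combination -this

variable {P} {A : Type u} [CommRing A] [Algebra F A]

/-- Elements of `ℂ_∞⟨A⟩` are approximated by sums of `a ⊗ c` with `c` in a finite subset of
`K_∞^s`. -/
theorem Tate.exists_finset_sub_mem_ball (x : Tate F A (Cinf P)) (r : {r : ℝ // 0 < r}) :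
    ∃ s : Finset (KinfSep P), ∃ y ∈ AddSubgroup.closure
      {z | ∃ (a : A) (c : KinfSep P), c ∈ s ∧ z = toTate F A (Cinf P) (a ⊗ₜ toCinf P c)},
      x - y ∈ Tate.ball F A (Cinf P) r := by
  classical
  obtain ⟨x₀, hx₀⟩ := Tate.exists_sub_mem_ball x r
  suffices h : ∃ s : Finset (KinfSep P), ∃ y ∈ AddSubgroup.closure
      {z | ∃ (a : A) (c : KinfSep P), c ∈ s ∧ z = toTate F A (Cinf P) (a ⊗ₜ toCinf P c)},
      toTate F A (Cinf P) x₀ - y ∈ Tate.ball F A (Cinf P) r by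
    obtain ⟨s, y, hy, h⟩ := h
    exact ⟨s, y, hy, by rw [← sub_add_sub_cancel x (toTate F A (Cinf P) x₀)]; exact add_mem hx₀ h⟩
  clear hx₀
  induction x₀ using TensorProduct.induction_on with
  | zero => exact ⟨∅, 0, zero_mem _, by simp⟩
  | tmul a c =>
    obtain ⟨c', hc'⟩ := Metric.denseRange_iff.1 (denseRange_toCinf P) c r r.2
    refine ⟨{c'}, _, AddSubgroup.subset_closure ⟨a, c', by simp, rfl⟩, ?_⟩
    rw [← map_sub, ← TensorProduct.tmul_sub]
    exact Tate.toTate_tmul_mem_ball a (by rw [← dist_eq_norm]; exact hc'.le)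
  | add x y hx hy =>
    obtain ⟨s, x', hx', hx⟩ := hx
    obtain ⟨t, y', hy', hy⟩ := hy
    refine ⟨s ∪ t, x' + y', add_mem (AddSubgroup.closure_mono ?_ hx')
      (AddSubgroup.closure_mono ?_ hy'), ?_⟩
    · rintro _ ⟨a, c, hc, rfl⟩
      exact ⟨a, c, Finset.mem_union_left t hc, rfl⟩
    · rintro _ ⟨a, c, hc, rfl⟩
      exact ⟨a, c, Finset.mem_union_right s hc, rfl⟩
    · rw [map_add, add_sub_add_comm]
      exact add_mem hx hy

/-- `1 - τ` is surjective on `ℂ_∞⟨A⟩`. -/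
theorem Tate.exists_sub_frob_eq (y : Tate F A (Cinf P)) :
    ∃ x, x - Tate.frob F A (Cinf P) x = y := by
  -- Up to a small error, handled by the series, `y` is a sum of terms `a ⊗ c` with `c ∈ K_∞^s`. For
  -- such a term, `d - d ^ q = c` gives the preimage `a ⊗ d`.
  obtain ⟨s, z, hz, hyz⟩ := Tate.exists_finset_sub_mem_ball y ⟨1 / 2, by norm_num⟩
  obtain ⟨x₁, hx₁⟩ := Tate.exists_sub_frob_eq_of_mem_ball hyz
  have h : AddSubgroup.closure {z | ∃ (a : A) (c : KinfSep P), c ∈ s ∧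
      z = toTate F A (Cinf P) (a ⊗ₜ toCinf P c)} ≤
      (AddMonoidHom.id _ - (Tate.frob F A (Cinf P)).toAddMonoidHom).range := by
    rw [AddSubgroup.closure_le]
    rintro _ ⟨a, c, -, rfl⟩
    obtain ⟨d, rfl⟩ := exists_sub_pow_card_eq P c
    refine ⟨toTate F A (Cinf P) (a ⊗ₜ toCinf P d), ?_⟩
    change toTate F A (Cinf P) (a ⊗ₜ toCinf P d) - Tate.frob F A (Cinf P) _ = _
    rw [Tate.frob_tmul, ← map_sub, ← TensorProduct.tmul_sub, map_sub, map_pow]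
  obtain ⟨x₂, hx₂⟩ := h hz
  refine ⟨x₁ + x₂, ?_⟩
  have hx₂' : x₂ - Tate.frob F A (Cinf P) x₂ = z := hx₂
  rw [map_add, add_sub_add_comm, hx₁, hx₂', sub_add_cancel]

end Cinf

/-! ### Clearing the poles along `𝔧` -/

section Poles

theorem InvAlong.ι_surjective_of_isUnit {R : Type u} [CommRing R] (j : Ideal R) {N : Type u}
    [AddCommGroup N] [Module R N] (hR : ∀ s ∈ R⁰, IsUnit s) :
    Function.Surjective (InvAlong.ι j N) := by
  intro z
  obtain ⟨⟨m, s⟩, hm⟩ := IsLocalizedModule.surj R⁰ (LocalizedModule.mkLinearMap R⁰ N) z.1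
  obtain ⟨t, ht⟩ := (hR s s.2).exists_left_inv
  refine ⟨t • m, Subtype.ext ?_⟩
  change LocalizedModule.mkLinearMap R⁰ N (t • m) = z.1
  rw [map_smul, ← hm, Submonoid.smul_def, smul_smul, ht, one_smul]

variable {F K : Type u} [Field F] [Fintype F] [Field K] [Algebra F K] (P : ClosedPoint F K)

/-- There is an element of `A ⊗ K` that clears poles along `𝔧` and is invertible in `L⟨A⟩` for
every extension `L` of `K` as a valued field. -/
theorem exists_clearsPoles [IsCurveFunctionField F K] : ∃ u : P.regularAway ⊗[F] K,
    ClearsPoles F P.regularAway K u ∧ ∀ (L : Type u) [NormedField L] [Algebra F L] [Algebra K L]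
      [IsScalarTower F K L], (∀ k : K, ‖algebraMap K L k‖ = P.abv k) →
      ∃ v, algebraMap _ (Tate F P.regularAway L) u * v = 1 := by
  by_cases h : ∃ a : P.regularAway, (a : K) ∉ P.localRing
  · obtain ⟨a, ha⟩ := h
    refine ⟨a ⊗ₜ 1 - 1 ⊗ₜ algebraMap P.regularAway K a, fun N _ _ z => ?_, fun L _ _ _ _ hL =>
      Tate.exists_mul_eq_one (by rw [hL]; exact P.one_lt_abv ha)⟩
    obtain ⟨n, hn⟩ := z.2
    have hu : a ⊗ₜ 1 - 1 ⊗ₜ algebraMap P.regularAway K a ∈ idealJ F P.regularAway K := by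
      rw [idealJ, RingHom.mem_ker, map_sub]
      simp
    obtain ⟨m, hm⟩ := hn _ (Ideal.pow_mem_pow hu n)
    exact ⟨n, m, Subtype.ext hm.symm⟩
  -- Here every element of `A` is regular everywhere, hence constant, so every element of `A ⊗ K` is
  -- `1 ⊗ k`. Nonzerodivisors are then units and `u = 1` suffices.
  · push Not at h
    refine ⟨1, fun N _ _ z => ?_, fun L _ _ _ _ _ => ⟨1, by simp⟩⟩
    have hR (x : P.regularAway ⊗[F] K) : ∃ k : K, x = 1 ⊗ₜ k := by
      induction x using TensorProduct.induction_on with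
      | zero => exact ⟨0, by simp⟩
      | add x y hx hy =>
        obtain ⟨k, rfl⟩ := hx
        obtain ⟨l, rfl⟩ := hy
        exact ⟨k + l, by rw [TensorProduct.tmul_add]⟩
      | tmul a k =>
        obtain ⟨c, hc⟩ := P.mem_range_of_mem a.2 (h a)
        have : a = c • (1 : P.regularAway) := Subtype.ext (by
          rw [← hc]; simp [Algebra.smul_def])
        exact ⟨c • k, by rw [this, TensorProduct.smul_tmul]⟩
    obtain ⟨m, hm⟩ := InvAlong.ι_surjective_of_isUnit (idealJ F P.regularAway K) (N := N)
      (fun x hx => by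
        obtain ⟨k, rfl⟩ := hR x
        rcases eq_or_ne k 0 with rfl | hk0
        · rw [TensorProduct.tmul_zero] at hx ⊢
          -- If zero is a nonzerodivisor, the ring is trivial and zero is a unit.
          exact isUnit_zero_iff.2 ((mem_nonZeroDivisors_iff.1 hx).1 1 (zero_mul 1)).symm
        · refine IsUnit.of_mul_eq_one (1 ⊗ₜ k⁻¹) ?_
          rw [Algebra.TensorProduct.tmul_mul_tmul, mul_inv_cancel₀ hk0, mul_one]
          rfl) z
    exact ⟨0, m, by rw [hm, pow_zero, one_smul]⟩

end Poles

/-! ### Finite generation of the Betti realization -/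

/-- Finiteness descends along a ring extension of which the base is a direct summand. -/
theorem finite_of_retraction {A T V : Type u} [CommRing A] [CommRing T] [Algebra A T]
    [AddCommGroup V] [Module A V] (ψ : T →ₗ[A] A) (hψ : ψ 1 = 1)
    [Module.Finite T (T ⊗[A] V)] : Module.Finite A V := by
  have hspan : Submodule.span T (Set.range fun v : V => (1 : T) ⊗ₜ[A] v) = ⊤ := by
    refine (Submodule.eq_top_iff').2 fun x => ?_
    induction x using TensorProduct.induction_on with
    | zero => exact zero_mem _
    | add x y hx hy => exact add_mem hx hy
    | tmul t v =>
      rw [← mul_one t, ← smul_eq_mul, ← TensorProduct.smul_tmul']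
      exact Submodule.smul_mem _ _ (Submodule.subset_span ⟨v, rfl⟩)
  obtain ⟨s, hs, hs'⟩ := (Submodule.fg_span_iff_fg_span_finset_subset _).1
    (hspan ▸ Module.Finite.fg_top : (Submodule.span T _).FG)
  -- The generators of `T ⊗ V` may be taken of the form `1 ⊗ v`; applying `ψ ⊗ id` to an expression
  -- of `1 ⊗ v` in them expresses `v` in terms of finitely many elements of `V`.
  let r : T ⊗[A] V →ₗ[A] V := (TensorProduct.lid A V).toLinearMap ∘ₗ LinearMap.rTensor V ψ
  have hr (t : T) (v : V) : r (t ⊗ₜ v) = ψ t • v := by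
    change TensorProduct.lid A V (LinearMap.rTensor V ψ (t ⊗ₜ v)) = _
    rw [LinearMap.rTensor_tmul, TensorProduct.lid_tmul]
  -- As `r` is only `A`-linear, the induction must carry all multiples `t • x` along.
  have hmem (x : T ⊗[A] V) (hx : x ∈ Submodule.span T (s : Set (T ⊗[A] V))) :
      ∀ t : T, r (t • x) ∈ Submodule.span A (r '' s) := by
    induction hx using Submodule.span_induction with
    | zero => simp
    | add x y _ _ hx hy => intro t; rw [smul_add, map_add]; exact add_mem (hx t) (hy t)
    | smul t' x _ hx => intro t; rw [smul_smul]; exact hx _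
    | mem x hx =>
      intro t
      obtain ⟨v, rfl⟩ := hs hx
      have hv : r ((1 : T) ⊗ₜ v) = v := by rw [hr, hψ, one_smul]
      rw [TensorProduct.smul_tmul', smul_eq_mul, mul_one, hr]
      exact Submodule.smul_mem _ _ (Submodule.subset_span ⟨_, hx, hv⟩)
  refine ⟨Submodule.fg_def.2 ⟨r '' s, s.finite_toSet.image r, Submodule.eq_top_iff'.2 fun v => ?_⟩⟩
  have h1 : (1 : T) ⊗ₜ[A] v ∈ Submodule.span T (s : Set (T ⊗[A] V)) := by
    rw [← hs', hspan]; trivial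
  have h2 := hmem _ h1 1
  rwa [one_smul, hr, hψ, one_smul] at h2

section Finiteness

variable (F A L : Type u) [Field F] [Fintype F] [CommRing A] [Algebra F A] [NormedField L]
  [Algebra F L] [IsUltrametricDist L]

/-- The ball of radius `1 / 2` is an `F`-subspace that does not contain `1`, so some functional
kills it but not `1`. Vanishing on a ball makes the functional continuous for the discrete topology
of `F`. -/
theorem exists_linearMap_eq_one : ∃ φ : L →ₗ[F] F, φ 1 = 1 ∧ ∀ c, ‖c‖ ≤ 1 / 2 → φ c = 0 := by
  let B : Submodule F L :=
    { carrier := {c | ‖c‖ ≤ 1 / 2}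
      zero_mem' := by simp
      add_mem' hx hy := (IsUltrametricDist.norm_add_le_max _ _).trans (max_le hx hy)
      smul_mem' f c hc := (norm_smul_le_of_finite f c).trans hc }
  have h1 : (1 : L) ∉ B := fun h => by
    have : ‖(1 : L)‖ ≤ 1 / 2 := h
    rw [norm_one] at this
    norm_num at this
  obtain ⟨f, hf, hB⟩ := Submodule.exists_le_ker_of_notMem h1
  refine ⟨(f 1)⁻¹ • f, inv_mul_cancel₀ hf, fun c hc => ?_⟩
  have : f c = 0 := hB hc
  rw [LinearMap.smul_apply, this, smul_zero]

/-- `A` is a direct summand of the `A`-module `L⟨A⟩`. -/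
theorem Tate.exists_retraction : ∃ ψ : Tate F A L →ₗ[A] A, ψ 1 = 1 := by
  obtain ⟨φ, hφ1, hφ⟩ := exists_linearMap_eq_one F L
  let ψ₀ : A ⊗[F] L →+ A :=
    ((TensorProduct.rid F A).toLinearMap ∘ₗ LinearMap.lTensor A φ).toAddMonoidHom
  have hψ₀ (a : A) (c : L) : ψ₀ (a ⊗ₜ c) = φ c • a := by
    change TensorProduct.rid F A (LinearMap.lTensor A φ (a ⊗ₜ c)) = _
    rw [LinearMap.lTensor_tmul, TensorProduct.rid_tmul]
  -- For discrete `A`, the map `id ⊗ φ` vanishes on an open subgroup, so it is continuous and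
  -- extends to the completion.
  let _ : UniformSpace A := ⊥
  have : DiscreteUniformity A := inferInstance
  let ψ₁ : PreTate F A L →+ A := ψ₀.comp (PreTate.of F A L).symm.toRingHom.toAddMonoidHom
  have hc : Continuous ψ₁ := by
    refine continuous_of_continuousAt_zero ψ₁ ?_
    rw [ContinuousAt, map_zero, nhds_discrete A, Filter.tendsto_pure]
    filter_upwards [(PreTate.ringSubgroupsBasis F A L).hasBasis_nhds_zero.mem_of_mem
      (i := ⟨1 / 2, by norm_num⟩) trivial] with x hx
    induction hx using AddSubgroup.closure_induction with
    | zero => exact map_zero _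
    | add x y _ _ h1 h2 => rw [map_add, h1, h2, add_zero]
    | neg x _ h1 => rw [map_neg, h1, neg_zero]
    | mem x hx =>
      obtain ⟨a, c, hc, rfl⟩ := hx
      exact (hψ₀ a c).trans (by rw [hφ c hc, zero_smul])
  let ψ : UniformSpace.Completion (PreTate F A L) →+ A := ψ₁.extension hc
  have hψc : Continuous ψ := AddMonoidHom.continuous_extension ψ₁ hc
  have hψ (x : A ⊗[F] L) : ψ (toTate F A L x) = ψ₀ x := AddMonoidHom.extension_coe ψ₁ hc _
  refine ⟨{ ψ with map_smul' := fun a x => ?_ }, ?_⟩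
  · have h1 (y : A ⊗[F] L) : a • toTate F A L y = toTate F A L ((a ⊗ₜ 1) * y) := by
      rw [Algebra.smul_def, map_mul]; rfl
    have h2 : Continuous fun x : Tate F A L => a • x := by
      simp only [Algebra.smul_def]
      exact continuous_const.mul continuous_id
    refine congrFun (Tate.hom_ext (f := fun x : Tate F A L => ψ (a • x : Tate F A L))
      (g := fun x : Tate F A L => a • ψ x) (hψc.comp h2) ?_ fun y => ?_) x
    · exact (continuous_of_discreteTopology (f := fun b : A => a • b)).comp hψc
    · simp only [h1, hψ]
      induction y using TensorProduct.induction_on with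
      | zero => simp
      | add y z hy hz => rw [mul_add, map_add, map_add, hy, hz, smul_add]
      | tmul b c =>
        rw [Algebra.TensorProduct.tmul_mul_tmul, one_mul, hψ₀, hψ₀, smul_eq_mul, mul_smul_comm]
  · change ψ (1 : Tate F A L) = 1
    rw [← map_one (toTate F A L), hψ, Algebra.TensorProduct.one_def, hψ₀, hφ1, one_smul]

end Finiteness

/-! ### Solutions of `x = Φ τ(x)` as limits of iterates -/

section FixedPoint

variable {F A L : Type u} [Field F] [Fintype F] [CommRing A] [Algebra F A] [NormedField L]
  [Algebra F L]

/-- A solution of `x = Φ τ(x)` lies in every closed `τ`-stable subring that contains `Φ` and a good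
approximation of `x`. -/
theorem Tate.mem_of_eq_sum_mul_frob {ι : Type*} [Fintype ι] {S : Subring (Tate F A L)}
    (hS : IsClosed (S : Set (Tate F A L))) (hSτ : ∀ x ∈ S, Tate.frob F A L x ∈ S)
    {Φ : ι → ι → Tate F A L} (hΦS : ∀ i j, Φ i j ∈ S) {s r : {r : ℝ // 0 < r}}
    (hΦ : ∀ i j, Φ i j ∈ Tate.ball F A L s) (hr : (r : ℝ) ≤ 1) (hsr : (s : ℝ) * r ≤ 1 / 2)
    {x y : ι → Tate F A L} (hx : ∀ i, x i = ∑ j, Φ i j * Tate.frob F A L (x j))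
    (hy : ∀ i, y i ∈ S) (hxy : ∀ i, x i - y i ∈ Tate.ball F A L r) (i : ι) : x i ∈ S := by
  let y' : ℕ → ι → Tate F A L :=
    fun k => (fun y i => ∑ j, Φ i j * Tate.frob F A L (y j))^[k] y
  have hsucc (k : ℕ) (i : ι) : y' (k + 1) i = ∑ j, Φ i j * Tate.frob F A L (y' k j) :=
    congrFun (Function.iterate_succ_apply' _ _ _) i
  have hS' (k : ℕ) : ∀ i, y' k i ∈ S := by
    induction k with
    | zero => exact hy
    | succ k ih =>
      intro i
      rw [hsucc]
      exact sum_mem fun j _ => mul_mem (hΦS i j) (hSτ _ (ih j))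
  -- The error obeys `x - y' (k + 1) = Φ τ(x - y' k)`, so its radius halves at each step.
  have hd (k : ℕ) : ∀ i, x i - y' k i ∈
      Tate.ball F A L ⟨r * (1 / 2) ^ k, mul_pos r.2 (by positivity)⟩ := by
    induction k with
    | zero => exact fun i => by simpa [y'] using hxy i
    | succ k ih =>
      intro i
      rw [hsucc, hx, ← Finset.sum_sub_distrib]
      refine sum_mem fun j _ => ?_
      rw [← mul_sub, ← map_sub]
      have hk : (1 / 2 : ℝ) ^ k ≤ 1 := pow_le_one₀ (by norm_num) (by norm_num)
      have hrk : (r : ℝ) * (1 / 2) ^ k ≤ r := mul_le_of_le_one_right r.2.le hk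
      refine Tate.mul_frob_mem_ball (hΦ i j) (ih j) (hrk.trans hr) ?_ ?_
      · exact (mul_le_mul_of_nonneg_left hrk s.2.le).trans hsr
      · exact (by ring : ((r : ℝ) * (1 / 2) ^ k) * (1 / 2) = r * (1 / 2) ^ (k + 1)).le
  have hlim : Filter.Tendsto (fun k => y' k i) Filter.atTop (nhds (x i)) := by
    have := (Tate.tendsto_zero_of_mem_ball (fun k => hd k i)
      (tendsto_half_pow_mul r)).const_sub (x i)
    simpa using this
  exact hS.mem_of_tendsto hlim (Filter.Eventually.of_forall fun k => hS' k i)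

end FixedPoint

/-! ### Coordinates on `M ⊗ L⟨A⟩` -/

section Coordinates

variable {F A K : Type u} [Field F] [Fintype F] [CommRing A] [Algebra F A] [Field K] [Algebra F K]
  [Algebra A K] [IsScalarTower F A K] (M : AMotive F A K)
  (L : Type u) [NormedField L] [Algebra F L] [Algebra K L] [IsScalarTower F K L]

namespace AMotive

/-- Dual bases: coordinates on `M ⊗ L⟨A⟩`. -/
theorem exists_coordinates : ∃ (n : ℕ) (m : Fin n → M.carrier)
    (c : Fin n → M.Ext L →ₗ[Tate F A L] Tate F A L),
      (∀ x : M.Ext L, x = ∑ i, c i x • ((1 : Tate F A L) ⊗ₜ m i)) ∧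
      ∀ i (s : Tate F A L) (m' : M.carrier),
        ∃ b : A ⊗[F] K, c i (s ⊗ₜ m') = s * algebraMap (A ⊗[F] K) (Tate F A L) b := by
  -- `M` is a direct summand of a free module of rank `n`; the `c i` are the base changes of the
  -- components of the inclusion `g`.
  obtain ⟨n, f, g, -, -, hfg⟩ :=
    Module.Finite.exists_comp_eq_id_of_projective (A ⊗[F] K) M.carrier
  let c (i : Fin n) : M.Ext L →ₗ[Tate F A L] Tate F A L := LinearMap.liftBaseChange (Tate F A L)
    (Algebra.linearMap (A ⊗[F] K) (Tate F A L) ∘ₗ LinearMap.proj i ∘ₗ g)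
  have hc (i) (s : Tate F A L) (m : M.carrier) :
      c i (s ⊗ₜ m) = s * algebraMap (A ⊗[F] K) (Tate F A L) (g m i) :=
    LinearMap.liftBaseChange_tmul ..
  refine ⟨n, fun i => f (Pi.single i 1), c, fun x => ?_, fun i s m' => ⟨_, hc i s m'⟩⟩
  induction x using TensorProduct.induction_on with
  | zero => simp
  | add x y hx hy =>
    simp only [map_add, add_smul, Finset.sum_add_distrib]
    rw [← hx, ← hy]
  | tmul s m =>
    have hm : m = ∑ i, g m i • f (Pi.single i 1) := by
      conv_lhs => rw [← LinearMap.id_apply (R := A ⊗[F] K) m, ← hfg, LinearMap.comp_apply,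
        pi_eq_sum_univ' (g m), map_sum]
      simp only [map_smul]
    conv_lhs => rw [hm, TensorProduct.tmul_sum]
    refine Finset.sum_congr rfl fun i _ => ?_
    rw [hc, TensorProduct.smul_tmul', smul_eq_mul, mul_one, ← TensorProduct.smul_tmul,
      Algebra.smul_def, mul_comm]

variable {M L}

/-- On elements of `M`, the only denominators of `τ_M` are powers of `u`. This is why the matrix of
`frobExt` is defined over every `L⟨A⟩` in which `u` is invertible. -/
theorem frobExt_one_tmul {u : A ⊗[F] K} (hu : ClearsPoles F A K u) {v : Tate F A L}
    (huv : algebraMap _ (Tate F A L) u * v = 1) (hb : Function.Bijective (M.toInv L))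
    (m : M.carrier) : ∃ (n : ℕ) (m' : M.carrier), frobExt hb (1 ⊗ₜ m) = (v ^ n) ⊗ₜ m' := by
  obtain ⟨n, m', h⟩ := hu M.carrier (M.τ (InvAlong.ι (idealJ F A K) _ (Pullback.mk _ _ m)))
  refine ⟨n, m', hb.1 ?_⟩
  rw [toInv_frobExt, pullExt_tmul, map_one]
  change (1 : Tate F A L) ⊗ₜ[A ⊗[F] K] M.τ (InvAlong.ι (idealJ F A K) _ (Pullback.mk _ _ m)) =
    (v ^ n) ⊗ₜ InvAlong.ι (idealJ F A K) _ m'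
  rw [← h, ← TensorProduct.smul_tmul, Algebra.smul_def, map_pow, ← mul_pow, huv, one_pow]

end AMotive

end Coordinates

/-! ### Descent of `M_B` to a finite extension of `K_∞` -/

section FieldOfDefinition

variable {F K : Type u} [Field F] [Fintype F] [Field K] [Algebra F K] {P : ClosedPoint F K}
  {A : Type u} [CommRing A] [Algebra F A]

theorem norm_algebraMap_intermediateField (L : IntermediateField (Kinf P) (Cinf P)) (k : K) :
    ‖algebraMap K L k‖ = P.abv k :=
  norm_algebraMap_Cinf P k

variable (A) in
/-- The subalgebra `L⟨A⟩` of `ℂ_∞⟨A⟩`. -/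
def tateSubalgebra (L : IntermediateField (Kinf P) (Cinf P)) :
    Subalgebra (A ⊗[F] K) (Tate F A (Cinf P)) :=
  (Tate.mapAlg F A K (L.val.restrictScalars K) continuous_subtype_val).range

theorem isClosed_tateSubalgebra (L : IntermediateField (Kinf P) (Cinf P)) :
    IsClosed (tateSubalgebra A L : Set (Tate F A (Cinf P))) :=
  Tate.isClosed_range_mapAlg (L.val.restrictScalars K) (fun _ => rfl) continuous_subtype_val

theorem frob_mem_tateSubalgebra (L : IntermediateField (Kinf P) (Cinf P)) {x : Tate F A (Cinf P)}
    (hx : x ∈ tateSubalgebra A L) : Tate.frob F A (Cinf P) x ∈ tateSubalgebra A L := by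
  obtain ⟨y, rfl⟩ := hx
  exact ⟨Tate.frob F A L y,
    Tate.mapAlg_frob F A K (L.val.restrictScalars K) continuous_subtype_val y⟩

theorem toTate_tmul_mem_tateSubalgebra (L : IntermediateField (Kinf P) (Cinf P)) (a : A)
    {c : Cinf P} (hc : c ∈ L) : toTate F A (Cinf P) (a ⊗ₜ c) ∈ tateSubalgebra A L :=
  ⟨toTate F A L (a ⊗ₜ ⟨c, hc⟩),
    Tate.mapAlg_toTate F A K (L.val.restrictScalars K) continuous_subtype_val _⟩

/-- Inverses are unique, so the inverse of `u` found in `L⟨A⟩` is the one in `ℂ_∞⟨A⟩`. -/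
theorem mem_tateSubalgebra_of_mul_eq_one {u : A ⊗[F] K} (L : IntermediateField (Kinf P) (Cinf P))
    (hL : ∃ v, algebraMap _ (Tate F A L) u * v = 1) {v : Tate F A (Cinf P)}
    (hv : algebraMap _ (Tate F A (Cinf P)) u * v = 1) : v ∈ tateSubalgebra A L := by
  obtain ⟨w, hw⟩ := hL
  let g := Tate.mapAlg F A K (L.val.restrictScalars K) continuous_subtype_val
  have h : algebraMap _ (Tate F A (Cinf P)) u * g w = 1 := by
    rw [← g.commutes, ← map_mul, hw, map_one]
  refine ⟨w, ?_⟩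
  change g w = v
  calc g w = g w * (algebraMap _ (Tate F A (Cinf P)) u * v) := by rw [hv, mul_one]
    _ = (algebraMap _ (Tate F A (Cinf P)) u * g w) * v := by ring
    _ = v := by rw [h, one_mul]

variable [Algebra A K] [IsScalarTower F A K]

namespace AMotive

/-- By rigid analytic triviality `M_B` becomes isomorphic to the finite module `M ⊗ ℂ_∞⟨A⟩` over
`ℂ_∞⟨A⟩`; finiteness descends along the retraction onto `A`. -/
theorem finite_betti {M : AMotive F A K} (hM : M.IsRigidAnalyticallyTrivial (Cinf P)) :
    Module.Finite A (M.betti (Cinf P)) := by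
  obtain ⟨ψ, hψ⟩ := Tate.exists_retraction F A (Cinf P)
  have : Module.Finite (Tate F A (Cinf P)) (Tate F A (Cinf P) ⊗[A] M.betti (Cinf P)) :=
    Module.Finite.equiv (LinearEquiv.ofBijective _ hM).symm
  exact finite_of_retraction (V := M.betti (Cinf P)) ψ hψ

/-- The Betti realization of a rigid analytically trivial `A`-motive is defined over a finite
extension of `K_∞` in `K_∞^s`. -/
theorem exists_betti_le_range {u : A ⊗[F] K} (hu : ClearsPoles F A K u)
    (huL : ∀ L : IntermediateField (Kinf P) (Cinf P), ∃ v, algebraMap _ (Tate F A L) u * v = 1)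
    (huC : ∃ v, algebraMap _ (Tate F A (Cinf P)) u * v = 1)
    {M : AMotive F A K} (hM : M.IsRigidAnalyticallyTrivial (Cinf P)) :
    ∃ E : IntermediateField (Kinf P) (KinfSep P), FiniteDimensional (Kinf P) E ∧
      ∀ ω ∈ M.betti (Cinf P), ω ∈ LinearMap.range
        (M.mapExt (L := E.map (IsScalarTower.toAlgHom (Kinf P) (KinfSep P) (Cinf P)))
          (L' := Cinf P) ((IntermediateField.val _).restrictScalars K) continuous_subtype_val) := by
  classical
  obtain ⟨v, hv⟩ := huC
  have hb := bijective_toInv M (Cinf P) hu hv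
  obtain ⟨n, m, c, hsum, hc⟩ := M.exists_coordinates (Cinf P)
  let Φ (i j : Fin n) : Tate F A (Cinf P) := c i (frobExt hb (1 ⊗ₜ m j))
  have hΦL (L : IntermediateField (Kinf P) (Cinf P)) (i j) : Φ i j ∈ tateSubalgebra A L := by
    obtain ⟨k, m', h⟩ := frobExt_one_tmul hu hv hb (m j)
    obtain ⟨b, hb'⟩ := hc i (v ^ k) m'
    change c i (frobExt hb (1 ⊗ₜ m j)) ∈ _
    rw [h, hb']
    exact mul_mem (pow_mem (mem_tateSubalgebra_of_mul_eq_one L (huL L) hv) k)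
      (Subalgebra.algebraMap_mem _ b)
  have hfix (ω : M.Ext (Cinf P)) (hω : ω ∈ M.betti (Cinf P)) (i : Fin n) :
      c i ω = ∑ j, Φ i j * Tate.frob F A (Cinf P) (c j ω) := by
    conv_lhs => rw [← (mem_betti_iff_frobExt hb).1 hω, hsum ω, map_sum, map_sum]
    refine Finset.sum_congr rfl fun j _ => ?_
    rw [frobExt_smul, map_smul, smul_eq_mul, mul_comm]
  choose ρ hρ using fun i j => Tate.exists_mem_ball (Φ i j)
  -- A common radius for all entries of `Φ`. The summand `1` ensures `s ≥ 1`, so that `r = 1 / (2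
  -- s)` satisfies both `r ≤ 1` and `s r ≤ 1 / 2`.
  let s : {r : ℝ // 0 < r} := ⟨1 + ∑ i, ∑ j, (ρ i j : ℝ),
    add_pos_of_pos_of_nonneg one_pos
      (Finset.sum_nonneg fun i _ => Finset.sum_nonneg fun j _ => (ρ i j).2.le)⟩
  have hs1 : (1 : ℝ) ≤ s := le_add_of_nonneg_right
    (Finset.sum_nonneg fun i _ => Finset.sum_nonneg fun j _ => (ρ i j).2.le)
  have hΦs (i j) : Φ i j ∈ Tate.ball F A (Cinf P) s := by
    refine Tate.ball_mono (show (ρ i j : ℝ) ≤ s from ?_) (hρ i j)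
    have h1 : (ρ i j : ℝ) ≤ ∑ j, (ρ i j : ℝ) :=
      Finset.single_le_sum (f := fun j => (ρ i j : ℝ)) (fun j _ => (ρ i j).2.le)
        (Finset.mem_univ j)
    have h2 : ∑ j, (ρ i j : ℝ) ≤ ∑ i, ∑ j, (ρ i j : ℝ) :=
      Finset.single_le_sum (f := fun i => ∑ j, (ρ i j : ℝ))
        (fun i _ => Finset.sum_nonneg fun j _ => (ρ i j).2.le) (Finset.mem_univ i)
    exact (h1.trans h2).trans (le_add_of_nonneg_left zero_le_one)
  let r : {r : ℝ // 0 < r} := ⟨1 / (2 * s), by have := s.2; positivity⟩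
  have hsr : (s : ℝ) * r ≤ 1 / 2 := by
    have := s.2.ne'
    change (s : ℝ) * (1 / (2 * s)) ≤ 1 / 2
    field_simp
    exact le_rfl
  have hr1 : (r : ℝ) ≤ 1 := by
    have h : (r : ℝ) ≤ s * r := le_mul_of_one_le_left r.2.le hs1
    linarith
  have := finite_betti hM
  obtain ⟨W, hW⟩ := (Module.Finite.fg_top : (⊤ : Submodule A (M.betti (Cinf P))).FG)
  choose t y hy hty using fun (w : M.betti (Cinf P)) (i : Fin n) =>
    Tate.exists_finset_sub_mem_ball (c i w) r
  -- All coefficients occurring in the approximations to the coordinates of the finitely many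
  -- generators `W` of `M_B`.
  let S : Finset (KinfSep P) := W.biUnion fun w => Finset.univ.biUnion fun i => t w i
  let E : IntermediateField (Kinf P) (KinfSep P) := IntermediateField.adjoin (Kinf P) S
  refine ⟨E, IntermediateField.finiteDimensional_adjoin fun x _ =>
    Algebra.IsIntegral.isIntegral x, ?_⟩
  let L := E.map (IsScalarTower.toAlgHom (Kinf P) (KinfSep P) (Cinf P))
  have hcL (w) (hw : w ∈ W) (i : Fin n) : c i w ∈ tateSubalgebra A L := by
    refine Tate.mem_of_eq_sum_mul_frob (S := (tateSubalgebra A L).toSubring)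
      (isClosed_tateSubalgebra L) (fun x hx => frob_mem_tateSubalgebra L hx) (hΦL L) hΦs hr1 hsr
      (x := fun i => c i w) (y := y w) (hfix w w.2) (fun i => ?_) (hty w) i
    have hle : AddSubgroup.closure {z | ∃ (a : A) (d : KinfSep P), d ∈ t w i ∧
        z = toTate F A (Cinf P) (a ⊗ₜ toCinf P d)} ≤
          (tateSubalgebra A L).toSubring.toAddSubgroup := by
      rw [AddSubgroup.closure_le]
      rintro _ ⟨a, d, hd, rfl⟩
      refine toTate_tmul_mem_tateSubalgebra L a ⟨d, IntermediateField.subset_adjoin _ _ ?_, rfl⟩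
      exact Finset.mem_biUnion.2 ⟨w, hw, Finset.mem_biUnion.2 ⟨i, Finset.mem_univ i, hd⟩⟩
    exact hle (hy w i)
  -- The elements defined over `L` form an `A`-submodule, so it is enough that it contains the
  -- generators.
  let V : Submodule A (M.betti (Cinf P)) := ((LinearMap.range (M.mapExt (L := L) (L' := Cinf P)
    ((IntermediateField.val _).restrictScalars K) continuous_subtype_val)).restrictScalars A).comap
      (M.betti (Cinf P)).subtype
  have hV : ⊤ ≤ V := by
    rw [← hW, Submodule.span_le]
    intro w hw
    change (w : M.Ext (Cinf P)) ∈ LinearMap.range _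
    rw [hsum w]
    refine sum_mem fun i _ => ?_
    obtain ⟨z, hz⟩ := hcL w hw i
    refine ⟨z ⊗ₜ m i, ?_⟩
    refine (mapExt_tmul M _ _ z (m i)).trans ?_
    rw [TensorProduct.smul_tmul', smul_eq_mul, mul_one, ← hz]
    rfl
  exact fun ω hω => hV (x := ⟨ω, hω⟩) trivial

end AMotive

end FieldOfDefinition

/-! ### Exactness of the Betti realization -/

section Exactness

variable {F K : Type u} [Field F] [Fintype F] [Field K] [Algebra F K] {P : ClosedPoint F K}
  {A : Type u} [CommRing A] [Algebra F A] [Algebra A K] [IsScalarTower F A K]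

namespace AMotive

/-- `1 - τ` is surjective on `M ⊗ ℂ_∞⟨A⟩` if `M` is rigid analytically trivial. -/
theorem exists_sub_frobExt_eq {M : AMotive F A K} (hb : Function.Bijective (M.toInv (Cinf P)))
    (hM : M.IsRigidAnalyticallyTrivial (Cinf P)) (y : M.Ext (Cinf P)) :
    ∃ x, x - frobExt hb x = y := by
  obtain ⟨z, rfl⟩ := hM.2 y
  induction z using TensorProduct.induction_on with
  | zero => exact ⟨0, by simp⟩
  | add z z' hz hz' =>
    obtain ⟨x, hx⟩ := hz
    obtain ⟨x', hx'⟩ := hz'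
    exact ⟨x + x', by rw [map_add, map_add, add_sub_add_comm, hx, hx']⟩
  | tmul s ω =>
    -- As `ω` is fixed by `frobExt`, the operator acts on `s • ω` through `τ` on the scalar `s`
    -- alone.
    obtain ⟨d, hd⟩ := Tate.exists_sub_frob_eq s
    refine ⟨d • (ω : M.Ext (Cinf P)), ?_⟩
    rw [frobExt_smul, (mem_betti_iff_frobExt hb).1 ω.2, LinearMap.liftBaseChange_tmul,
      ← hd]
    exact (sub_smul d (Tate.frob F A (Cinf P) d) (ω : M.Ext (Cinf P))).symm

variable {M' M M'' : AMotive F A K} {f : M' ⟶ M} {g : M ⟶ M''}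

theorem injective_bettiMap (hf : Function.Injective f.lin) (hfg : Function.Exact f.lin g.lin)
    (hg : Function.Surjective g.lin) : Function.Injective (bettiMap (Cinf P) f) :=
  fun _ _ h => Subtype.ext (injective_extMap f g hf hfg hg (congrArg Subtype.val h))

theorem exact_bettiMap {u : A ⊗[F] K} (hu : ClearsPoles F A K u)
    (huC : ∃ v, algebraMap _ (Tate F A (Cinf P)) u * v = 1)
    (hf : Function.Injective f.lin) (hfg : Function.Exact f.lin g.lin)
    (hg : Function.Surjective g.lin) :
    Function.Exact (bettiMap (Cinf P) f) (bettiMap (Cinf P) g) := by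
  obtain ⟨v, hv⟩ := huC
  have hb := bijective_toInv M (Cinf P) hu hv
  have hb' := bijective_toInv M' (Cinf P) hu hv
  intro ω
  constructor
  · intro h
    obtain ⟨ω', hω'⟩ := (exact_extMap (L := Cinf P) f g hfg hg ω).1 (congrArg Subtype.val h)
    refine ⟨⟨ω', (mem_betti_iff_frobExt hb').2 (injective_extMap f g hf hfg hg ?_)⟩,
      Subtype.ext hω'⟩
    rw [extMap_frobExt hb' hb, hω', (mem_betti_iff_frobExt hb).1 ω.2]
  · rintro ⟨ω', rfl⟩
    exact Subtype.ext ((exact_extMap (L := Cinf P) f g hfg hg _).2 ⟨ω', rfl⟩)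

/-- This is the connecting map of the snake lemma: for a lift `x` of `ω`, the element `x - frobExt
x` comes from some `y` over `M'`. Writing `y = z - frobExt z` and subtracting the image of `z` turns
`x` into a fixed lift. -/
theorem surjective_bettiMap {u : A ⊗[F] K} (hu : ClearsPoles F A K u)
    (huC : ∃ v, algebraMap _ (Tate F A (Cinf P)) u * v = 1)
    (hM' : M'.IsRigidAnalyticallyTrivial (Cinf P)) (hfg : Function.Exact f.lin g.lin)
    (hg : Function.Surjective g.lin) : Function.Surjective (bettiMap (Cinf P) g) := by
  obtain ⟨v, hv⟩ := huC
  have hb := bijective_toInv M (Cinf P) hu hv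
  have hb' := bijective_toInv M' (Cinf P) hu hv
  have hb'' := bijective_toInv M'' (Cinf P) hu hv
  intro ω
  obtain ⟨x, hx⟩ := surjective_extMap (L := Cinf P) g hg ω
  have h0 : extMap (Cinf P) g (x - frobExt hb x) = 0 := by
    rw [map_sub, extMap_frobExt hb hb'', hx, (mem_betti_iff_frobExt hb'').1 ω.2, sub_self]
  obtain ⟨y, hy⟩ := (exact_extMap (L := Cinf P) f g hfg hg _).1 h0
  obtain ⟨z, hz⟩ := exists_sub_frobExt_eq hb' hM' y
  refine ⟨⟨x - extMap (Cinf P) f z, (mem_betti_iff_frobExt hb).2 ?_⟩, Subtype.ext ?_⟩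
  · rw [← hz, map_sub, extMap_frobExt hb' hb] at hy
    rw [map_sub, sub_eq_sub_iff_add_eq_add, add_comm]
    rwa [sub_eq_sub_iff_add_eq_add] at hy
  · change extMap (Cinf P) g (x - extMap (Cinf P) f z) = ω
    rw [map_sub, hx, (exact_extMap (L := Cinf P) f g hfg hg _).2 ⟨z, rfl⟩, sub_zero]

end AMotive

end Exactness

/-! ### Continuity of the Galois action -/

section Continuity

variable {F K : Type u} [Field F] [Fintype F] [Field K] [Algebra F K] {P : ClosedPoint F K}

theorem bettiRho_eq_self (M : AMotK P) (E : IntermediateField (Kinf P) (KinfSep P))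
    {σ : Ginf P} (hσ : σ ∈ E.fixingSubgroup) (ω : M.betti (Cinf P))
    (hω : (ω : M.Ext (Cinf P)) ∈ LinearMap.range
      (M.mapExt (L := E.map (IsScalarTower.toAlgHom (Kinf P) (KinfSep P) (Cinf P)))
        (L' := Cinf P) ((IntermediateField.val _).restrictScalars K) continuous_subtype_val)) :
    bettiRho M σ ω = ω := by
  obtain ⟨y, hy⟩ := hω
  refine Subtype.ext ?_
  rw [bettiRho_apply, ← hy]
  -- On the image of `E` in `ℂ_∞`, the inclusion and its composite with `σ` agree.
  refine (AMotive.mapExt_comp M _ _ _ _ _ _ ?_ y).symm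
  rintro ⟨_, e, he, rfl⟩
  exact ((galCinf_toCinf P σ e).trans (congrArg (toCinf P) (hσ ⟨e, he⟩))).symm

/-- For each `ω`, the map `σ ↦ σ ω` is constant on the cosets of the fixing subgroup of `E`, which
is open because `E` is finite over `K_∞`. -/
theorem isContinuousRep_bettiRho (M : AMotK P) (E : IntermediateField (Kinf P) (KinfSep P))
    [FiniteDimensional (Kinf P) E] (h : ∀ ω ∈ M.betti (Cinf P), ω ∈ LinearMap.range
      (M.mapExt (L := E.map (IsScalarTower.toAlgHom (Kinf P) (KinfSep P) (Cinf P)))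
        (L' := Cinf P) ((IntermediateField.val _).restrictScalars K) continuous_subtype_val)) :
    IsContinuousRep P.regularAway (Ginf P) ((bettiFunctor P).obj M) := by
  let _ : TopologicalSpace (M.betti (Cinf P)) := ⊥
  have : DiscreteTopology (M.betti (Cinf P)) := ⟨rfl⟩
  change Continuous fun p : Ginf P × M.betti (Cinf P) => bettiRho M p.1 p.2
  refine continuous_prod_of_discrete_right.2 fun ω => ?_
  refine (IsLocallyConstant.iff_exists_open _).2 (fun σ => ?_) |>.continuous
  refine ⟨(fun σ' => σ⁻¹ * σ') ⁻¹' (E.fixingSubgroup : Set (Ginf P)),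
    E.fixingSubgroup_isOpen.preimage (continuous_const.mul continuous_id), ?_, fun σ' hσ' => ?_⟩
  · change σ⁻¹ * σ ∈ E.fixingSubgroup
    rw [inv_mul_cancel]
    exact one_mem _
  · have h1 := bettiRho_eq_self M E hσ' ω (h ω ω.2)
    change bettiRho M σ' ω = bettiRho M σ ω
    rw [show σ' = σ * (σ⁻¹ * σ') by group, map_mul, Module.End.mul_apply, h1]

end Continuity

/-! ### Field of definition and continuity for the ring `A` of the curve -/

section FieldOfDefinition

variable {F K : Type u} [Field F] [Fintype F] [Field K] [Algebra F K] (P : ClosedPoint F K)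

theorem exists_finiteDimensional_betti_le_range [IsCurveFunctionField F K] (M : AMotK P)
    (hM : M.IsRigidAnalyticallyTrivial (Cinf P)) :
    ∃ E : IntermediateField (Kinf P) (KinfSep P), FiniteDimensional (Kinf P) E ∧
      ∀ ω ∈ M.betti (Cinf P), ω ∈ LinearMap.range
        (M.mapExt (L := E.map (IsScalarTower.toAlgHom (Kinf P) (KinfSep P) (Cinf P)))
          (L' := Cinf P) ((IntermediateField.val _).restrictScalars K) continuous_subtype_val) := by
  obtain ⟨u, hu, huL⟩ := exists_clearsPoles P
  have huI (L : IntermediateField (Kinf P) (Cinf P)) :=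
    huL L (norm_algebraMap_intermediateField L)
  have huC := huL (Cinf P) (norm_algebraMap_Cinf P)
  exact AMotive.exists_betti_le_range hu huI huC hM

theorem exists_finite_separable_betti_le_range [IsCurveFunctionField F K] (M : AMotK P)
    (hM : M.IsRigidAnalyticallyTrivial (Cinf P)) :
    ∃ L : IntermediateField (Kinf P) (Cinf P),
      FiniteDimensional (Kinf P) L ∧ Algebra.IsSeparable (Kinf P) L ∧
      ∀ ω ∈ M.betti (Cinf P), ω ∈ LinearMap.range
        (M.mapExt (L := L) (L' := Cinf P) (L.val.restrictScalars K) continuous_subtype_val) := by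
  obtain ⟨E, hE, h⟩ := exists_finiteDimensional_betti_le_range P M hM
  have : Algebra.IsSeparable (Kinf P) (KinfSep P) := IsSepClosure.separable
  have : Algebra.IsSeparable (Kinf P) E := inferInstance
  -- Finiteness and separability pass from `E` to its image in `ℂ_∞`.
  let e := E.equivMap (IsScalarTower.toAlgHom (Kinf P) (KinfSep P) (Cinf P))
  exact ⟨_, e.toLinearEquiv.finiteDimensional, AlgEquiv.Algebra.isSeparable e, h⟩

theorem isContinuousRep_bettiRat [IsCurveFunctionField F K] (M : AMotRat P) :
    IsContinuousRep _ _ ((bettiRat P).obj M) := by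
  obtain ⟨E, hE, h⟩ := exists_finiteDimensional_betti_le_range P M.obj M.property
  exact isContinuousRep_bettiRho M.obj E h

end FieldOfDefinition

/-! ### The functor to continuous representations -/

section Functor

variable {F K : Type u} [Field F] [Fintype F] [Field K] [Algebra F K] {P : ClosedPoint F K}

/-- The maps underlying `bettiCont` are the `bettiMap`s by definition, which reduces exactness of
representations to exactness of `A`-modules. -/
theorem bettiCont_isShortExact {M' M M'' : AMotRat P}
    (hcont : ∀ M : AMotRat P, IsContinuousRep _ _ ((bettiRat P).obj M)) (f : M' ⟶ M) (g : M ⟶ M'')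
    (h1 : Function.Injective (AMotive.bettiMap (Cinf P) f.hom))
    (h2 : Function.Exact (AMotive.bettiMap (Cinf P) f.hom) (AMotive.bettiMap (Cinf P) g.hom))
    (h3 : Function.Surjective (AMotive.bettiMap (Cinf P) g.hom)) :
    ContRep.IsShortExact ((bettiCont hcont).map f) ((bettiCont hcont).map g) :=
  ⟨h1, h2, h3⟩

theorem bettiCont_isShortExact_of_isShortExact [IsCurveFunctionField F K] {M' M M'' : AMotRat P}
    (hcont : ∀ M : AMotRat P, IsContinuousRep _ _ ((bettiRat P).obj M)) (f : M' ⟶ M) (g : M ⟶ M'')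
    (h : AMotRat.IsShortExact f g) :
    ContRep.IsShortExact ((bettiCont hcont).map f) ((bettiCont hcont).map g) := by
  obtain ⟨u, hu, huL⟩ := exists_clearsPoles P
  have huC := huL (Cinf P) (norm_algebraMap_Cinf P)
  obtain ⟨h1, h2, h3⟩ := h
  exact bettiCont_isShortExact hcont f g (AMotive.injective_bettiMap h1 h2 h3)
    (AMotive.exact_bettiMap hu huC h1 h2 h3)
    (AMotive.surjective_bettiMap hu huC M'.property h2 h3)

theorem bettiFunctor_additive : (bettiFunctor P).Additive where
  map_add {M _ f g} := Rep.hom_ext <| Representation.IntertwiningMap.ext <|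
    LinearMap.ext fun (ω : M.betti (Cinf P)) => Subtype.ext <|
      LinearMap.congr_fun (LinearMap.lTensor_add _ f.lin g.lin) ω.1

theorem bettiCont_additive (hcont : ∀ M : AMotRat P, IsContinuousRep _ _ ((bettiRat P).obj M)) :
    (bettiCont hcont).Additive where
  map_add {_ _ f g} := by
    have := bettiFunctor_additive (P := P)
    exact ObjectProperty.hom_ext _ ((bettiFunctor P).map_add (f := f.hom) (g := g.hom))

end Functor

end AMot

end

theorem mainTheorem9 {F K : Type u} [Field F] [Fintype F] [Field K] [Algebra F K]
    [IsCurveFunctionField F K] (P : ClosedPoint F K) :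
    -- `M_B` is contained in `M ⊗ L⟨A⟩` for some finite separable `L / K_∞` in `ℂ_∞`
    (∀ M : AMotK P, M.IsRigidAnalyticallyTrivial (Cinf P) →
      ∃ L : IntermediateField (Kinf P) (Cinf P),
        FiniteDimensional (Kinf P) L ∧ Algebra.IsSeparable (Kinf P) L ∧
        ∀ ω ∈ M.betti (Cinf P), ω ∈ LinearMap.range
          (M.mapExt (L := L) (L' := Cinf P) (L.val.restrictScalars K) continuous_subtype_val)) ∧
    -- `G_∞` acts continuously on the discrete module `M_B`, and the resulting functor is exact
    ∃ hcont : ∀ M : AMotRat P, IsContinuousRep _ _ ((bettiRat P).obj M),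
      (bettiCont hcont).Additive ∧
      ∀ {M' M M'' : AMotRat P} (f : M' ⟶ M) (g : M ⟶ M''), AMotRat.IsShortExact f g →
        ContRep.IsShortExact ((bettiCont hcont).map f) ((bettiCont hcont).map g) := by
  exact ⟨exists_finite_separable_betti_le_range P, isContinuousRep_bettiRat P,
    bettiCont_additive _, fun f g h => bettiCont_isShortExact_of_isShortExact _ f g h⟩
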